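/- Let $(X,\mathscr B,\mu)$ be a $\sigma$-finite measure space and let $T:X\to X$ be an invertible nonsingular transformation, i.e. $T$ is measurable, has a measurable two-sided inverse modulo $\mu$-null sets, and satisfies $\mu(T^{-1}A)=0\iff\mu(A)=0$ for all $A\in\mathscr B$. Suppose that there is no finite $T$-invariant measure equivalent to $\mu$. Let $\lambda$ be Lebesgue measure on $[0,\infty)$. A *rank-one transformation* of $[0,\infty)$ is obtained by cutting and stacking: start with the column $C_0=\{[0,1)\}$; given a column $C_n$ (a finite sequence of disjoint intervals of equal length, called levels), cut it into $r_n\ge 2$ subcolumns of equal width, put $s_{n,i}\ge 0$ new intervals (spacers) on top of the $i$-th subcolumn ($0\le i<r_n$), each new spacer abutting the part of $[0,\infty)$ already used, and stack each subcolumn on top of the one to its left to get $C_{n+1}$. One assumes that the total measure of $C_n$ tends to infinity. The transformation is the pointwise limit of the maps that translate each level of $C_n$ other than the top one to the level above it. It is a *skyscraper transformation* if $r_n=2$ and $s_{n,0}=0$ for all $n$ (spacers are only added on the right subcolumn). Then: 1. There is a skyscraper (in particular rank-one) transformation $S$ of $[0,\infty)$ such that $T\times S$ is not conservative, hence not ergodic,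 for $\mu\times\lambda$. 2. There is a rank-one transformation $S$ of $[0,\infty)$ such that $T\times S$ is not conservative, hence not ergodic, and $S$ is rigid: there is a strictly increasing sequence $(n_i)$ of natural numbers with $\liminf_{i\to\infty}\lambda(S^{n_i}A\cap A)\ge\lambda(A)$ for all measurable $A$ with $0<\lambda(A)<\infty$. 3. There is a rank-one transformation $S$ of $[0,\infty)$ such that $T\times S$ is not conservative, hence not ergodic, and $S$ has infinite ergodic index: for every $k\ge1$ the $k$-fold product $S\times\cdots\times S$ is ergodic for $\lambda^{k}$. In each case $S$ is invertible modulo null sets and preserves $\lambda$. Here a nonsingular transformation $R$ of a measure space $(Z,\rho)$ is conservative if for every measurable $A$ with $\rho(A)>0$ there is $n\ge1$ with $\rho(R^{-n}A\cap A)>0$, and ergodic if every measurable $A$ with $R^{-1}A=A$ is null or conull. -/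

import Mathlib

open MeasureTheory Filter Set
open scoped NNReal

/-- `T` is an invertible nonsingular transformation of `(X, μ)`. Invertibility is understood up to
null sets: `T` has a measurable two-sided inverse modulo `μ`. -/
structure IsInvertibleNonsingular {X : Type*} [MeasurableSpace X] (T : X → X) (μ : Measure X) :
    Prop where
  measurable : Measurable T
  invertible : ∃ T' : X → X, Measurable T' ∧ (∀ᵐ x ∂μ, T' (T x) = x) ∧ (∀ᵐ x ∂μ, T (T' x) = x)
  null_iff : ∀ A : Set X, MeasurableSet A → (μ (T ⁻¹' A) = 0 ↔ μ A = 0)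

/-- There is a finite `T`-invariant measure equivalent to `μ`. -/
def HasFiniteInvariantMeasure {X : Type*} [MeasurableSpace X] (T : X → X) (μ : Measure X) : Prop :=
  ∃ ν : Measure X, IsFiniteMeasure ν ∧ ν ≪ μ ∧ μ ≪ ν ∧ MeasurePreserving T ν ν

/-- `S` is rigid along some strictly increasing sequence of times. (Used for invertible
measure-preserving `S`, for which `S⁻ⁿ A ∩ A` and `Sⁿ A ∩ A` have the same measure.) -/
def IsRigid {Y : Type*} [MeasurableSpace Y] (S : Y → Y) (m : Measure Y) : Prop :=
  ∃ n : ℕ → ℕ, StrictMono n ∧ ∀ A : Set Y, MeasurableSet A → 0 < m A → m A < ⊤ →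
    m A ≤ liminf (fun i => m (S^[n i] ⁻¹' A ∩ A)) atTop

/-- All finite Cartesian powers `S × ⋯ × S` of the measure-preserving map `S` are ergodic. -/
def HasInfiniteErgodicIndex {Y : Type*} [MeasurableSpace Y] (S : Y → Y) (m : Measure Y) : Prop :=
  ∀ k : ℕ, 1 ≤ k →
    Ergodic (fun (y : Fin k → Y) (i : Fin k) => S (y i)) (Measure.pi fun _ : Fin k => m)

/-- Lebesgue measure on the half-line `[0, ∞)`. -/
noncomputable def lebesgueHalfLine : Measure ℝ≥0 :=
  (volume : Measure ℝ).comap ((↑) : ℝ≥0 → ℝ)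

/-- Parameters of a cutting-and-stacking construction: at stage `n` the column is cut into
`cuts n ≥ 2` subcolumns, and `spacers n i` spacers are put on top of the `i`-th subcolumn
(`i < cuts n`, counted from the left; other values of `i` are irrelevant). -/
structure CuttingParams where
  cuts : ℕ → ℕ
  spacers : ℕ → ℕ → ℕ
  two_le_cuts : ∀ n, 2 ≤ cuts n

namespace CuttingParams

/-- The common length of the levels of the `n`-th column. -/
noncomputable def width (P : CuttingParams) (n : ℕ) : ℝ :=
  ∏ k ∈ Finset.range n, (1 / (P.cuts k : ℝ))

/-- The `n`-th column, as the list, from bottom to top, of the left endpoints of its levels; the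
level with left endpoint `a` is the interval `[a, a + P.width n)`. The `0`-th column is `[0,1)`.
The `n`-th column is cut into subcolumns of width `P.width (n + 1)`; its union is
`[0, length * P.width n)`, and the new spacers are taken one after the other, going up the
subcolumns from left to right, starting from the right end of that interval. Each subcolumn
with its spacers is stacked on top of the one to its left. -/
noncomputable def column (P : CuttingParams) : ℕ → List ℝ
  | 0 => [0]
  | n + 1 => (List.range (P.cuts n)).flatMap fun (i : ℕ) =>
      (P.column n).map (fun a => a + (i : ℝ) * P.width (n + 1)) ++
      (List.range (P.spacers n i)).map (fun (j : ℕ) =>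
        ((P.column n).length : ℝ) * P.width n +
          (((∑ l ∈ Finset.range i, P.spacers n l) + j : ℕ) : ℝ) * P.width (n + 1))

/-- The column map of the `n`-th column is defined at `x` and sends `x` to `y`: `x` lies in a level
that is not the top one, and `y` is its translate in the level immediately above. -/
def ColumnMapsTo (P : CuttingParams) (n : ℕ) (x y : ℝ) : Prop :=
  ∃ (i : ℕ) (h : i + 1 < (P.column n).length),
    x ∈ Ico ((P.column n)[i]) ((P.column n)[i] + P.width n) ∧
      y = x - (P.column n)[i] + (P.column n)[i + 1]

/-- `S` is the rank-one transformation of `[0, ∞)` built from `P`: the measures of the columns tend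
to infinity (so that the columns exhaust `[0, ∞)`), and `S` is the pointwise limit of the column
maps (which extend one another, so that their values at a point are eventually constant). -/
def Generates (P : CuttingParams) (S : ℝ≥0 → ℝ≥0) : Prop :=
  Tendsto (fun n => ((P.column n).length : ℝ) * P.width n) atTop atTop ∧
    ∀ x : ℝ≥0, ∀ᶠ n in atTop, P.ColumnMapsTo n x (S x)

end CuttingParams

/-- `S` is a (cutting-and-stacking) rank-one transformation of `[0, ∞)`. -/
def IsRankOne (S : ℝ≥0 → ℝ≥0) : Prop :=
  ∃ P : CuttingParams, P.Generates S

/-- `S` is a skyscraper transformation: a rank-one transformation of `[0, ∞)` for which every column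
is cut into two subcolumns and spacers are only added to the right one. -/
def IsSkyscraper (S : ℝ≥0 → ℝ≥0) : Prop :=
  ∃ P : CuttingParams, (∀ n, P.cuts n = 2 ∧ P.spacers n 0 = 0) ∧ P.Generates S

open scoped ENNReal Topology

/-! By Hajian and Kakutani, the absence of a finite equivalent invariant measure yields a set B of
positive measure for which the averages of m(T⁻ᵏB), with m a finite measure equivalent to μ, have
lower limit 0 (`exists_frequently_cesaroPreimage_lt`). A counting argument then gives arbitrarily
large h such that m(T⁻ᴺB) is tiny for every N within a prescribed distance M of one of h, 2h, …, rh
(`exists_lt_near_multiples`).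

On the other side, let I be the bottom level of column 1 of a cutting-and-stacking map S. If x and
Sᴺx lie in I, look at the last column for which they lie in different subcolumns: N differs from a
multiple of the height of that column by an amount depending only on earlier heights and on inner
spacers (`Generates.return_time_near_multiple`). That height can still be adjusted through the
spacers on the last subcolumn of the preceding stage, so it can be taken to be an h as above
(`exists_height`). Removing from B the sets T⁻ᴺB for all these N costs less than m(B). What is left
is a set A of positive measure having no return time in common with I, so A × I is wandering for T ×
S (`exists_generates_disjoint_return_times`).

The numbers of cuts and the inner spacers remain free, and they decide the additional property of S.
Two cuts without inner spacers give a skyscraper. Cuts tending to infinity without inner spacers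
give rigidity along the heights. Three cuts with one spacer on the middle subcolumn, as in Chacon's
map, make all powers ergodic: comparing subcolumns shows that a set invariant under the product is
invariant under S acting on one coordinate. -/

/-- Cesàro average of the measures of the preimages of `B` under the iterates of `T`. -/
noncomputable def cesaroPreimage {X : Type*} [MeasurableSpace X] (m : Measure X) (T : X → X)
    (n : ℕ) (B : Set X) : ℝ≥0∞ :=
  (∑ k ∈ Finset.range n, m (T^[k] ⁻¹' B)) / n

/-! ### Hajian–Kakutani: sets with small Cesàro averages -/

section Cesaro

variable {X : Type*} [MeasurableSpace X] {m : Measure X} {T : X → X}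

theorem cesaroPreimage_le [IsFiniteMeasure m] (n : ℕ) (B : Set X) :
    cesaroPreimage m T n B ≤ m univ := by
  refine ENNReal.div_le_of_le_mul ?_
  calc ∑ k ∈ Finset.range n, m (T^[k] ⁻¹' B) ≤ ∑ _k ∈ Finset.range n, m univ :=
        Finset.sum_le_sum fun k _ => measure_mono (subset_univ _)
    _ = m univ * n := by simp [mul_comm]

theorem cesaroPreimage_mono (n : ℕ) {A B : Set X} (h : A ⊆ B) :
    cesaroPreimage m T n A ≤ cesaroPreimage m T n B :=
  ENNReal.div_le_div_right (Finset.sum_le_sum fun _ _ => measure_mono (preimage_mono h)) _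

theorem cesaroPreimage_inter_add_diff (hT : Measurable T) (n : ℕ) (A : Set X) {B : Set X}
    (hB : MeasurableSet B) :
    cesaroPreimage m T n (A ∩ B) + cesaroPreimage m T n (A \ B) = cesaroPreimage m T n A := by
  unfold cesaroPreimage
  rw [ENNReal.div_add_div_same, ← Finset.sum_add_distrib]
  congr 1
  refine Finset.sum_congr rfl fun k _ => ?_
  rw [preimage_inter, preimage_sdiff]
  exact measure_inter_add_sdiff _ (hT.iterate k hB)

/-- The sums telescope; the two boundary terms vanish as `n` grows, so limits of the averages are
`T`-invariant. -/
theorem cesaroPreimage_preimage_add (n : ℕ) (B : Set X) :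
    cesaroPreimage m T n (T ⁻¹' B) + m B / n =
      cesaroPreimage m T n B + m (T^[n] ⁻¹' B) / n := by
  unfold cesaroPreimage
  rw [ENNReal.div_add_div_same, ENNReal.div_add_div_same]
  congr 1
  rw [← Finset.sum_range_succ, Finset.sum_range_succ']
  simp only [Function.iterate_zero, preimage_id_eq, id]
  congr 1
  refine Finset.sum_congr rfl fun k _ => ?_
  rw [← preimage_comp, ← Function.iterate_succ']

theorem measure_preimage_iterate_eq_zero (hT : Measurable T)
    (hnull : ∀ A, MeasurableSet A → (m (T ⁻¹' A) = 0 ↔ m A = 0)) {A : Set X} (hA : m A = 0)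
    (k : ℕ) : m (T^[k] ⁻¹' A) = 0 := by
  have hq : Measure.QuasiMeasurePreserving T m m :=
    ⟨hT, Measure.AbsolutelyContinuous.mk fun s hs h => by
      rw [Measure.map_apply hT hs]; exact (hnull s hs).2 h⟩
  exact (hq.iterate k).preimage_null hA

/-- Hajian–Kakutani: without a finite equivalent invariant measure there is a set of positive
measure whose preimages have Cesàro averages coming arbitrarily close to `0`. -/
theorem exists_frequently_cesaroPreimage_lt [IsFiniteMeasure m] (hT : Measurable T)
    (hnull : ∀ A, MeasurableSet A → (m (T ⁻¹' A) = 0 ↔ m A = 0))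
    (hfin : ¬ HasFiniteInvariantMeasure T m) :
    ∃ B, MeasurableSet B ∧ m B ≠ 0 ∧
      ∀ η : ℝ≥0∞, 0 < η → ∃ᶠ n in atTop, cesaroPreimage m T n B < η := by
  classical
  have hex : ∀ B : Set X, ∃ v : ℝ≥0∞,
      Tendsto (fun n => cesaroPreimage m T n B) (hyperfilter ℕ) (𝓝 v) := fun B =>
    ⟨_, ((hyperfilter ℕ).map fun n => cesaroPreimage m T n B).le_nhds_lim⟩
  -- Limits along an ultrafilter exist by compactness; `ν` is a finitely additive, `T`-invariant set
  -- function vanishing on null sets, but need not be countably additive.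
  choose ν hν using hex
  have hle : (hyperfilter ℕ : Filter ℕ) ≤ atTop := Nat.hyperfilter_le_atTop
  have hmono : ∀ {A B : Set X}, A ⊆ B → ν A ≤ ν B := fun h =>
    le_of_tendsto_of_tendsto' (hν _) (hν _) fun n => cesaroPreimage_mono n h
  have hadd : ∀ (A : Set X) {B : Set X}, MeasurableSet B → ν (A ∩ B) + ν (A \ B) = ν A :=
    fun A B hB => tendsto_nhds_unique
      (((hν _).add (hν _)).congr fun n => cesaroPreimage_inter_add_diff hT n A hB) (hν A)
  have hbound : ∀ B, ν B ≤ m univ := fun B => le_of_tendsto' (hν B) fun n => cesaroPreimage_le n B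
  have hzero : ∀ B, m B = 0 → ν B = 0 := fun B hB => by
    refine tendsto_nhds_unique (hν B) (tendsto_const_nhds.congr fun n => ?_)
    simp [cesaroPreimage, measure_preimage_iterate_eq_zero hT hnull hB]
  have hinv : ∀ B, ν (T ⁻¹' B) = ν B := fun B => by
    have hz : ∀ f : ℕ → ℝ≥0∞, (∀ n, f n ≤ m univ) →
        Tendsto (fun n : ℕ => f n / n) (hyperfilter ℕ) (𝓝 0) := fun f hf => by
      refine Tendsto.mono_left ?_ hle
      refine tendsto_of_tendsto_of_tendsto_of_le_of_le tendsto_const_nhds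
        (?_ : Tendsto (fun n : ℕ => m univ / n) atTop (𝓝 0)) (fun _ => zero_le)
        fun n => ENNReal.div_le_div_right (hf n) _
      exact ENNReal.Tendsto.const_div ENNReal.tendsto_nat_nhds_top (Or.inr (measure_ne_top m _))
        |>.trans (by simp)
    have h1 := (hν (T ⁻¹' B)).add (hz (fun _ => m B) fun _ => measure_mono (subset_univ _))
    have h2 := (hν B).add (hz (fun n => m (T^[n] ⁻¹' B)) fun _ => measure_mono (subset_univ _))
    simp only [add_zero] at h1 h2
    exact tendsto_nhds_unique h1 (h2.congr fun n => (cesaroPreimage_preimage_add n B).symm)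
  have hempty : ν ∅ = 0 := hzero _ measure_empty
  have hunion : ∀ (t : ℕ → Set X) (_ : ∀ i, MeasurableSet (t i)) (N : ℕ),
      ν (⋃ i ∈ Finset.range N, t i) ≤ ∑ i ∈ Finset.range N, ν (t i) := by
    intro t ht N
    induction N with
    | zero => simp [hempty]
    | succ N ih =>
      rw [Finset.sum_range_succ, ← hadd _ (ht N), add_comm]
      refine add_le_add ((hmono ?_).trans ih) (hmono inter_subset_right)
      rintro x ⟨hx, hxN⟩
      simp only [mem_iUnion, Finset.mem_range] at hx ⊢
      obtain ⟨i, hi, hxi⟩ := hx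
      exact ⟨i, (Nat.lt_succ_iff_lt_or_eq.1 hi).resolve_right (by rintro rfl; exact hxN hxi), hxi⟩
  -- The value `⊤` restricts useful covers to measurable sets. The outer measure generated by `f`
  -- yields a countably additive `ρ ≤ ν`.
  let f : Set X → ℝ≥0∞ := fun s => if MeasurableSet s then ν s else ⊤
  have hf : ∀ {s}, MeasurableSet s → f s = ν s := fun h => if_pos h
  have hf0 : f ∅ = 0 := by rw [hf .empty, hempty]
  let o : OuterMeasure X := OuterMeasure.ofFunction f hf0
  have hcar : ‹MeasurableSpace X› ≤ o.caratheodory := by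
    intro s hs
    refine OuterMeasure.ofFunction_caratheodory fun t => ?_
    by_cases ht : MeasurableSet t
    · rw [hf ht, hf (ht.inter hs), hf (ht.diff hs), hadd t hs]
    · simp [f, ht]
  let ρ : Measure X := o.toMeasure hcar
  have hρ : ∀ {s}, MeasurableSet s → ρ s = o s := fun h => toMeasure_apply _ _ h
  have hρle : ∀ {s}, MeasurableSet s → ρ s ≤ ν s := fun h => by
    rw [hρ h, ← hf h]; exact OuterMeasure.ofFunction_le _
  have hρfin : IsFiniteMeasure ρ :=
    ⟨((hρle .univ).trans (hbound _)).trans_lt (measure_lt_top m _)⟩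
  have hρpre : ∀ {s}, MeasurableSet s → ρ (T ⁻¹' s) ≤ ρ s := fun {s} h => by
    rw [hρ h, hρ (hT h), OuterMeasure.ofFunction_apply, OuterMeasure.ofFunction_apply]
    refine le_iInf fun t => le_iInf fun hst => ?_
    refine (iInf₂_le (fun i => T ⁻¹' t i) ?_).trans (ENNReal.tsum_le_tsum fun i => ?_)
    · rw [← preimage_iUnion]; exact preimage_mono hst
    · by_cases hti : MeasurableSet (t i)
      · rw [hf hti, hf (hT hti), hinv]
      · simp [f, hti]
  have hρinv : MeasurePreserving T ρ ρ := by
    refine ⟨hT, Measure.ext fun s hs => ?_⟩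
    rw [Measure.map_apply hT hs]
    -- The other inequality is `hρpre` for the complement, since `ρ` is finite.
    refine le_antisymm (hρpre hs) ?_
    have h1 := measure_add_measure_compl (μ := ρ) hs
    have h2 := measure_add_measure_compl (μ := ρ) (hT hs)
    rw [← preimage_compl, ← h1] at h2
    have h3 := hρpre hs.compl
    refine (ENNReal.add_le_add_iff_right (measure_ne_top ρ sᶜ)).1 ?_
    rw [← h2]
    gcongr
  have hρm : ρ ≪ m := Measure.AbsolutelyContinuous.mk fun s hs h =>
    le_antisymm ((hρle hs).trans (hzero s h).le) zero_le
  have hnac : ¬ m ≪ ρ := fun h => hfin ⟨ρ, hρfin, hρm, h, hρinv⟩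
  obtain ⟨B, hB, hρB, hmB⟩ : ∃ B, MeasurableSet B ∧ ρ B = 0 ∧ m B ≠ 0 := by
    by_contra! hcon
    exact hnac (Measure.AbsolutelyContinuous.mk hcon)
  obtain ⟨ε, hε, hεsum⟩ := ENNReal.exists_pos_sum_of_countable hmB ℕ
  -- As `ρ B = 0`, countable covers of `B` have arbitrarily small total `ν`; finitely many members
  -- already cover `B` up to small `m`-measure. Intersecting the resulting `E k` gives a set with `ν
  -- = 0` that still has positive `m`-measure.
  have hstep : ∀ k : ℕ, ∃ E ⊆ B, MeasurableSet E ∧ ν E ≤ ε k ∧ m (B \ E) ≤ ε k := by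
    intro k
    have hεk : (0 : ℝ≥0∞) < ε k := by exact_mod_cast hε k
    have hlt : (⨅ (t : ℕ → Set X) (_ : B ⊆ iUnion t), ∑' i, f (t i)) < ε k := by
      rw [← OuterMeasure.ofFunction_apply f hf0, ← hρ hB, hρB]; exact hεk
    obtain ⟨t, hlt⟩ := iInf_lt_iff.1 hlt
    obtain ⟨hBt, hlt⟩ := iInf_lt_iff.1 hlt
    have htm : ∀ i, MeasurableSet (t i) := by
      intro i
      by_contra hi
      have : f (t i) < ⊤ := ((ENNReal.le_tsum i).trans_lt hlt).trans ENNReal.coe_lt_top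
      simp [f, hi] at this
    let V : ℕ → Set X := fun N => B \ ⋃ i ∈ Finset.range N, t i
    have hVm : ∀ N, MeasurableSet (V N) := fun N =>
      hB.diff (Finset.measurableSet_biUnion _ fun i _ => htm i)
    have hVanti : Antitone V := fun N M h =>
      sdiff_subset_sdiff_right (biUnion_subset_biUnion_left fun i hi =>
        Finset.mem_range.2 ((Finset.mem_range.1 hi).trans_le h))
    have hVempty : ⋂ N, V N = ∅ := by
      refine eq_empty_of_forall_notMem fun x hx => ?_
      rw [mem_iInter] at hx
      obtain ⟨i, hi⟩ := mem_iUnion.1 (hBt (hx 0).1)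
      exact (hx (i + 1)).2 (mem_biUnion (Finset.mem_range.2 i.lt_succ_self) hi)
    have hlim := tendsto_measure_iInter_atTop (μ := m) (fun N => (hVm N).nullMeasurableSet) hVanti
      ⟨0, measure_ne_top m _⟩
    rw [hVempty, measure_empty] at hlim
    obtain ⟨N, hN⟩ := (hlim.eventually_lt_const hεk).exists
    refine ⟨B ∩ ⋃ i ∈ Finset.range N, t i, inter_subset_left,
      hB.inter (Finset.measurableSet_biUnion _ fun i _ => htm i), ?_, ?_⟩
    · refine ((hmono inter_subset_right).trans (hunion t htm N)).trans ?_
      calc ∑ i ∈ Finset.range N, ν (t i) = ∑ i ∈ Finset.range N, f (t i) :=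
            Finset.sum_congr rfl fun i _ => (hf (htm i)).symm
        _ ≤ ∑' i, f (t i) := ENNReal.sum_le_tsum _
        _ ≤ ε k := hlt.le
    · rw [sdiff_self_inter]; exact hN.le
  choose E hEB hEm hνE hmE using hstep
  refine ⟨⋂ k, E k, MeasurableSet.iInter hEm, fun h0 => ?_, fun η hη => ?_⟩
  · have : m B ≤ ∑' k, (ε k : ℝ≥0∞) := by
      calc m B ≤ m ((⋂ k, E k) ∪ ⋃ k, B \ E k) := by
            refine measure_mono fun x hx => ?_
            by_cases h : ∀ k, x ∈ E k
            · exact Or.inl (mem_iInter.2 h)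
            · push Not at h
              obtain ⟨k, hk⟩ := h
              exact Or.inr (mem_iUnion.2 ⟨k, hx, hk⟩)
        _ ≤ m (⋂ k, E k) + m (⋃ k, B \ E k) := measure_union_le _ _
        _ ≤ 0 + ∑' k, (ε k : ℝ≥0∞) := by
            gcongr
            · exact h0.le
            · exact (measure_iUnion_le _).trans (ENNReal.tsum_le_tsum hmE)
        _ = _ := zero_add _
    exact absurd hεsum this.not_gt
  · have hν0 : ν (⋂ k, E k) = 0 := by
      have hlim : Tendsto (fun k => (ε k : ℝ≥0∞)) atTop (𝓝 0) :=
        ENNReal.tendsto_atTop_zero_of_tsum_ne_top hεsum.ne_top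
      exact le_antisymm (ge_of_tendsto' hlim fun k =>
        (hmono (iInter_subset E k)).trans (hνE k)) zero_le
    have hev : ∀ᶠ n in (hyperfilter ℕ : Filter ℕ), cesaroPreimage m T n (⋂ k, E k) < η :=
      (hν _).eventually_lt_const (by rwa [hν0])
    exact hev.frequently.filter_mono hle

end Cesaro

/-! ### Windows around multiples of a large number -/

/-- If the averages of `f` come arbitrarily close to `0`, then `f` is small on all the windows of
radius `M` around `h, 2 h, …, r h`, for arbitrarily large `h`. -/
theorem exists_lt_near_multiples {f : ℕ → ℝ≥0∞}
    (hf : ∀ η : ℝ≥0∞, 0 < η → ∃ᶠ n : ℕ in atTop, (∑ k ∈ Finset.range n, f k) / n < η)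
    {ε : ℝ≥0∞} (hε : 0 < ε) (r M N₀ : ℕ) :
    ∃ h ≥ N₀, ∀ j, 1 ≤ j → j ≤ r → ∀ N, j * h ≤ N + M → N ≤ j * h + M → f N < ε := by
  classical
  by_contra! hcon
  have hr : 1 ≤ r := by
    obtain ⟨j, h1, h2, -⟩ := hcon N₀ le_rfl
    omega
  have hN : ∀ h, ∃ N, N₀ ≤ h → ε ≤ f N ∧
      ∃ j, 1 ≤ j ∧ j ≤ r ∧ j * h ≤ N + M ∧ N ≤ j * h + M := by
    intro h
    by_cases hh : N₀ ≤ h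
    · obtain ⟨j, h1, h2, N, h3, h4, h5⟩ := hcon h hh
      exact ⟨N, fun _ => ⟨h5, j, h1, h2, h3, h4⟩⟩
    · exact ⟨0, fun h' => absurd h' hh⟩
  -- If every `h ≥ N₀` fails, `g h` is a bad index near some multiple of `h`. The multiplier and the
  -- offset determine `h` from `g h`, so fibres have at most `c` elements and bad indices have
  -- positive lower density, against `hf`.
  choose g hg using hN
  set c : ℕ := r * (2 * M + 1) with hc
  have hc0 : 0 < c := by positivity
  have hD0 : ((2 * r * c : ℕ) : ℝ≥0∞) ≠ 0 := by
    have : 0 < 2 * r * c := by positivity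
    exact_mod_cast this.ne'
  have hDt : ((2 * r * c : ℕ) : ℝ≥0∞) ≠ ⊤ := ENNReal.natCast_ne_top _
  obtain ⟨n, hn, hlt⟩ := frequently_atTop.1
    (hf (ε / (2 * r * c : ℕ)) (ENNReal.div_pos hε.ne' hDt)) (2 * (M + r + r * N₀) + 1)
  -- `Q` is chosen so that `r * h + M < n` for all `h < N₀ + Q`; the lower bound on `n` makes `Q ≥ n
  -- / (2 * r)`.
  set Q : ℕ := (n - M) / r - N₀ with hQ
  have hdiv := Nat.div_add_mod (n - M) r
  have hmod := Nat.mod_lt (n - M) hr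
  have hle : N₀ ≤ (n - M) / r := by
    rw [Nat.le_div_iff_mul_le hr, mul_comm]; omega
  have hQ1 : (n - M) / r = N₀ + Q := by omega
  rw [hQ1, mul_add] at hdiv
  have hQ2 : n ≤ 2 * r * Q := by
    have : 2 * r * Q = 2 * (r * Q) := by ring
    omega
  let bad : Finset ℕ := (Finset.range n).filter fun k => ε ≤ f k
  have hmaps : ∀ h ∈ Finset.Ico N₀ (N₀ + Q), g h ∈ bad := by
    intro h hh
    rw [Finset.mem_Ico] at hh
    obtain ⟨h1, j, hj1, hj2, -, hj4⟩ := hg h hh.1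
    refine Finset.mem_filter.2 ⟨Finset.mem_range.2 ?_, h1⟩
    have : j * h ≤ r * (h + 1) - r := by
      rw [mul_add, mul_one, Nat.add_sub_cancel]; exact Nat.mul_le_mul_right _ hj2
    have h2 : r * (h + 1) ≤ r * (N₀ + Q) := Nat.mul_le_mul_left _ (by omega)
    rw [mul_add r N₀ Q] at h2
    omega
  have hfib : ∀ b ∈ bad, ((Finset.Ico N₀ (N₀ + Q)).filter fun h => g h = b).card ≤ c := by
    intro b _
    calc _ ≤ ((Finset.Icc 1 r ×ˢ Finset.range (2 * M + 1)).image
          fun p : ℕ × ℕ => (b + M - p.2) / p.1).card := by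
            refine Finset.card_le_card fun h hh => ?_
            rw [Finset.mem_filter, Finset.mem_Ico] at hh
            obtain ⟨-, j, hj1, hj2, hj3, hj4⟩ := hg h hh.1.1
            rw [hh.2] at hj3 hj4
            refine Finset.mem_image.2 ⟨(j, b + M - j * h), ?_, ?_⟩
            · simp only [Finset.mem_product, Finset.mem_Icc, Finset.mem_range]
              omega
            · have : b + M - (b + M - j * h) = j * h := by omega
              simp only [this]
              exact Nat.mul_div_cancel_left _ hj1
      _ ≤ _ := Finset.card_image_le
      _ = c := by simp [hc]
  have hcard := Finset.card_le_mul_card_image_of_maps_to hmaps c hfib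
  rw [Nat.card_Ico, Nat.add_sub_cancel_left] at hcard
  have hcount : n ≤ 2 * r * c * bad.card := by
    calc n ≤ 2 * r * Q := hQ2
      _ ≤ 2 * r * (c * bad.card) := Nat.mul_le_mul_left _ hcard
      _ = _ := by ring
  have hsum : bad.card * ε ≤ ∑ k ∈ Finset.range n, f k := by
    calc (bad.card : ℝ≥0∞) * ε = ∑ _k ∈ bad, ε := by simp
      _ ≤ ∑ k ∈ bad, f k := Finset.sum_le_sum fun k hk => (Finset.mem_filter.1 hk).2
      _ ≤ _ := Finset.sum_le_sum_of_subset (Finset.filter_subset _ _)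
  have hn0 : (n : ℝ≥0∞) ≠ 0 := by
    have : n ≠ 0 := by omega
    exact_mod_cast this
  rw [ENNReal.div_lt_iff (Or.inl hn0) (Or.inl (ENNReal.natCast_ne_top _))] at hlt
  have : (n : ℝ≥0∞) * (ε / (2 * r * c : ℕ)) ≤ bad.card * ε := by
    calc (n : ℝ≥0∞) * (ε / (2 * r * c : ℕ))
        ≤ ((2 * r * c * bad.card : ℕ) : ℝ≥0∞) * (ε / (2 * r * c : ℕ)) := by
          gcongr
      _ = bad.card * (((2 * r * c : ℕ) : ℝ≥0∞) * (ε / (2 * r * c : ℕ))) := by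
          push_cast; ring
      _ = bad.card * ε := by rw [ENNReal.mul_div_cancel hD0 hDt]
  rw [mul_comm] at hlt
  exact absurd (this.trans hsum) hlt.not_ge

/-! ### Indices in concatenated lists -/

theorem length_flatMap_range {α : Type*} (f : ℕ → List α) (r : ℕ) :
    ((List.range r).flatMap f).length = ∑ l ∈ Finset.range r, (f l).length := by
  induction r with
  | zero => simp
  | succ r ih => rw [List.range_succ, List.flatMap_append, List.length_append, ih,
      Finset.sum_range_succ]; simp

theorem getD_flatMap_range {α : Type*} (f : ℕ → List α) (d : α) {r i j : ℕ} (hi : i < r)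
    (hj : j < (f i).length) :
    ((List.range r).flatMap f).getD (∑ l ∈ Finset.range i, (f l).length + j) d =
      (f i).getD j d := by
  induction r with
  | zero => omega
  | succ r ih =>
    rw [List.range_succ, List.flatMap_append]
    rcases Nat.lt_succ_iff_lt_or_eq.1 hi with h | rfl
    · rw [List.getD_append _ _ _ _ ?_, ih h]
      rw [length_flatMap_range]
      calc _ < ∑ l ∈ Finset.range (i + 1), (f l).length := by
            rw [Finset.sum_range_succ]; omega
        _ ≤ _ := Finset.sum_le_sum_of_subset (Finset.range_subset_range.2 h)
    · rw [List.getD_append_right _ _ _ _ (by rw [length_flatMap_range]; omega),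
        length_flatMap_range, Nat.add_sub_cancel_left]
      simp

theorem exists_eq_sum_range_add {s : ℕ → ℕ} {r k : ℕ} (hk : k < ∑ l ∈ Finset.range r, s l) :
    ∃ i < r, ∃ j < s i, k = ∑ l ∈ Finset.range i, s l + j := by
  induction r with
  | zero => simp at hk
  | succ r ih =>
    by_cases h : k < ∑ l ∈ Finset.range r, s l
    · obtain ⟨i, hi, j, hj, rfl⟩ := ih h
      exact ⟨i, hi.trans r.lt_succ_self, j, hj, rfl⟩
    · rw [Finset.sum_range_succ] at hk
      exact ⟨r, r.lt_succ_self, k - ∑ l ∈ Finset.range r, s l, by omega, by omega⟩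

/-! ### Combinatorics of the columns -/

namespace CuttingParams

variable (P : CuttingParams)

/-- The number of levels of the `n`-th column. -/
noncomputable def height (n : ℕ) : ℕ := (P.column n).length

/-- The left endpoint of the `j`-th level of the `n`-th column. -/
noncomputable def left (n j : ℕ) : ℝ := (P.column n).getD j 0

/-- The index, in the `(n + 1)`-st column, of the bottom level of the `i`-th subcolumn of the
`n`-th column. -/
noncomputable def start (n i : ℕ) : ℕ := ∑ l ∈ Finset.range i, (P.height n + P.spacers n l)

/-- The `j`-th level of the `n`-th column. -/
def level (n j : ℕ) : Set ℝ≥0 := {x | (x : ℝ) ∈ Ico (P.left n j) (P.left n j + P.width n)}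

theorem cuts_pos (n : ℕ) : 0 < P.cuts n := two_pos.trans_le (P.two_le_cuts n)

theorem width_pos (n : ℕ) : 0 < P.width n :=
  Finset.prod_pos fun k _ => one_div_pos.2 (Nat.cast_pos.2 (P.cuts_pos k))

theorem width_eq (n : ℕ) : P.width n = P.cuts n * P.width (n + 1) := by
  have : (P.cuts n : ℝ) ≠ 0 := Nat.cast_ne_zero.2 (P.cuts_pos n).ne'
  rw [width, width, Finset.prod_range_succ]
  field_simp

theorem width_zero : P.width 0 = 1 := by simp [width]

theorem width_le (n : ℕ) : P.width n ≤ (1 / 2) ^ n := by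
  induction n with
  | zero => simp [width]
  | succ n ih =>
    have h1 := P.width_eq n
    have h2 : (2 : ℝ) ≤ P.cuts n := by exact_mod_cast P.two_le_cuts n
    have h3 := P.width_pos (n + 1)
    rw [pow_succ]
    nlinarith

theorem tendsto_width : Tendsto P.width atTop (𝓝 0) :=
  squeeze_zero (fun n => (P.width_pos n).le) P.width_le
    (tendsto_pow_atTop_nhds_zero_of_lt_one (by norm_num) (by norm_num))

theorem height_zero : P.height 0 = 1 := rfl

theorem height_succ_eq_start (n : ℕ) : P.height (n + 1) = P.start n (P.cuts n) := by
  rw [height, column, length_flatMap_range, start]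
  exact Finset.sum_congr rfl fun i _ => by simp [height]

theorem start_eq (n i : ℕ) :
    P.start n i = i * P.height n + ∑ l ∈ Finset.range i, P.spacers n l := by
  simp [start, Finset.sum_add_distrib]

theorem height_succ (n : ℕ) : P.height (n + 1) =
    P.cuts n * P.height n + ∑ l ∈ Finset.range (P.cuts n), P.spacers n l := by
  rw [height_succ_eq_start, start_eq]

theorem start_succ (n i : ℕ) :
    P.start n (i + 1) = P.start n i + P.height n + P.spacers n i := by
  rw [start, Finset.sum_range_succ, ← start, add_assoc]

theorem start_mono (n : ℕ) : Monotone (P.start n) :=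
  monotone_nat_of_le_succ fun i => by rw [start_succ]; omega

theorem start_add_height_add_spacers_le {n i : ℕ} (hi : i < P.cuts n) :
    P.start n i + P.height n + P.spacers n i ≤ P.height (n + 1) := by
  rw [← start_succ, height_succ_eq_start]; exact P.start_mono n hi

/-- The `i`-th subcolumn of the `n`-th column, with its spacers. -/
noncomputable def subcolumn (n i : ℕ) : List ℝ :=
  (P.column n).map (fun a => a + (i : ℝ) * P.width (n + 1)) ++
    (List.range (P.spacers n i)).map (fun (j : ℕ) =>
      ((P.column n).length : ℝ) * P.width n +
        (((∑ l ∈ Finset.range i, P.spacers n l) + j : ℕ) : ℝ) * P.width (n + 1))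

theorem left_succ_eq_subcolumn {n i j : ℕ} (hi : i < P.cuts n)
    (hj : j < P.height n + P.spacers n i) :
    P.left (n + 1) (P.start n i + j) = (P.subcolumn n i).getD j 0 := by
  have hlen : ∀ i, (P.subcolumn n i).length = P.height n + P.spacers n i := fun i => by
    simp [subcolumn, height]
  have := getD_flatMap_range (P.subcolumn n) 0 hi (hj.trans_eq (hlen i).symm)
  simp only [hlen] at this
  exact this

theorem left_succ {n i j : ℕ} (hi : i < P.cuts n) (hj : j < P.height n) :
    P.left (n + 1) (P.start n i + j) = P.left n j + i * P.width (n + 1) := by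
  have hj' : j < (P.column n).length := hj
  rw [P.left_succ_eq_subcolumn hi (by omega), subcolumn, left,
    List.getD_append _ _ _ _ (by simpa using hj'),
    List.getD_eq_getElem _ _ (by simpa using hj'), List.getElem_map,
    List.getD_eq_getElem _ _ hj']

theorem left_succ_spacer {n i j : ℕ} (hi : i < P.cuts n) (hj : j < P.spacers n i) :
    P.left (n + 1) (P.start n i + P.height n + j) = P.height n * P.width n +
      ((∑ l ∈ Finset.range i, P.spacers n l + j : ℕ) : ℝ) * P.width (n + 1) := by
  rw [add_assoc, P.left_succ_eq_subcolumn hi (by omega), subcolumn,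
    List.getD_append_right _ _ _ _ (by simp [height]),
    List.getD_eq_getElem _ _ (by simp [height]; omega)]
  simp [height]

/-- The levels tile the interval `[0, height * width)`. In the inductive step, the `c`-th cell of
the finer grid is either a piece of an old level, with `c % cuts` naming the subcolumn, or a spacer.
-/
theorem exists_left_eq {n c : ℕ} (hc : c < P.height n) :
    ∃ j < P.height n, P.left n j = c * P.width n := by
  induction n generalizing c with
  | zero =>
    rw [height_zero] at *
    obtain rfl : c = 0 := by omega
    exact ⟨0, one_pos, by simp [left, column]⟩
  | succ n ih =>
    by_cases h : c < P.cuts n * P.height n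
    · obtain ⟨j, hj, hl⟩ := ih (Nat.div_lt_of_lt_mul h)
      have hi := Nat.mod_lt c (P.cuts_pos n)
      have := P.start_add_height_add_spacers_le hi
      refine ⟨P.start n (c % P.cuts n) + j, by omega, ?_⟩
      rw [P.left_succ hi hj, hl, P.width_eq n, ← mul_assoc, ← add_mul]
      congr 1
      have := Nat.div_add_mod' c (P.cuts n)
      exact_mod_cast this
    · rw [height_succ] at hc
      obtain ⟨i, hi, j, hj, hk⟩ := exists_eq_sum_range_add (s := P.spacers n) (r := P.cuts n)
        (k := c - P.cuts n * P.height n) (by omega)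
      have := P.start_add_height_add_spacers_le hi
      refine ⟨P.start n i + P.height n + j, by omega, ?_⟩
      rw [P.left_succ_spacer hi hj, ← hk, P.width_eq n, ← mul_assoc, ← add_mul]
      congr 1
      have : P.height n * P.cuts n + (c - P.cuts n * P.height n) = c := by
        rw [mul_comm]; omega
      exact_mod_cast this

/-- The endpoints cover as many grid points as there are levels, so by counting nothing is repeated
and nothing else occurs. -/
theorem image_left (n : ℕ) : (Finset.range (P.height n)).image (P.left n) =
      (Finset.range (P.height n)).image (fun c : ℕ => (c : ℝ) * P.width n) ∧
    InjOn (P.left n) (Finset.range (P.height n)) := by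
  have hsub : (Finset.range (P.height n)).image (fun c : ℕ => (c : ℝ) * P.width n) ⊆
      (Finset.range (P.height n)).image (P.left n) := by
    intro x hx
    obtain ⟨c, hc, rfl⟩ := Finset.mem_image.1 hx
    obtain ⟨j, hj, h⟩ := P.exists_left_eq (Finset.mem_range.1 hc)
    exact Finset.mem_image.2 ⟨j, Finset.mem_range.2 hj, h⟩
  have hcard : ((Finset.range (P.height n)).image (fun c : ℕ => (c : ℝ) * P.width n)).card =
      P.height n := by
    rw [Finset.card_image_of_injective, Finset.card_range]
    intro a b hab
    exact_mod_cast mul_right_cancel₀ (P.width_pos n).ne' hab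
  have hle : ((Finset.range (P.height n)).image (P.left n)).card ≤ P.height n :=
    Finset.card_image_le.trans (Finset.card_range _).le
  refine ⟨(Finset.eq_of_subset_of_card_le hsub (by rw [hcard]; exact hle)).symm, ?_⟩
  refine Finset.card_image_iff.1 (le_antisymm Finset.card_image_le ?_)
  rw [Finset.card_range]
  exact hcard.ge.trans (Finset.card_le_card hsub)

theorem left_eq {n j : ℕ} (hj : j < P.height n) :
    ∃ c < P.height n, P.left n j = c * P.width n := by
  have : P.left n j ∈ (Finset.range (P.height n)).image (P.left n) :=
    Finset.mem_image_of_mem _ (Finset.mem_range.2 hj)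
  rw [(P.image_left n).1, Finset.mem_image] at this
  obtain ⟨c, hc, h⟩ := this
  exact ⟨c, Finset.mem_range.1 hc, h.symm⟩

theorem left_nonneg {n j : ℕ} (hj : j < P.height n) : 0 ≤ P.left n j := by
  obtain ⟨c, -, h⟩ := P.left_eq hj
  rw [h]; exact mul_nonneg (Nat.cast_nonneg c) (P.width_pos n).le

theorem exists_mem_level {n : ℕ} {x : ℝ≥0} (hx : (x : ℝ) < P.height n * P.width n) :
    ∃ j < P.height n, x ∈ P.level n j := by
  have hw := P.width_pos n
  have h1 : ⌊(x : ℝ) / P.width n⌋₊ < P.height n :=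
    (Nat.floor_lt (by positivity)).2 ((div_lt_iff₀ hw).2 hx)
  obtain ⟨j, hj, hl⟩ := P.exists_left_eq h1
  refine ⟨j, hj, ?_, ?_⟩
  · rw [hl]; exact (le_div_iff₀ hw).1 (Nat.floor_le (by positivity))
  · rw [hl, ← add_one_mul]; exact (div_lt_iff₀ hw).1 (Nat.lt_floor_add_one _)

theorem level_unique {n j j' : ℕ} (hj : j < P.height n) (hj' : j' < P.height n) {x : ℝ≥0}
    (hx : x ∈ P.level n j) (hx' : x ∈ P.level n j') : j = j' := by
  have hw := P.width_pos n
  obtain ⟨c, -, h⟩ := P.left_eq hj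
  obtain ⟨c', -, h'⟩ := P.left_eq hj'
  refine (P.image_left n).2 (Finset.mem_coe.2 (Finset.mem_range.2 hj))
    (Finset.mem_coe.2 (Finset.mem_range.2 hj')) ?_
  obtain ⟨h1, h2⟩ := hx
  obtain ⟨h3, h4⟩ := hx'
  rw [h, ← add_one_mul] at h2
  rw [h', ← add_one_mul] at h4
  rw [h] at h1
  rw [h'] at h3
  have e1 : (c : ℝ) < c' + 1 := lt_of_mul_lt_mul_right (h1.trans_lt h4) hw.le
  have e2 : (c' : ℝ) < c + 1 := lt_of_mul_lt_mul_right (h3.trans_lt h2) hw.le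
  have e3 : c < c' + 1 := by exact_mod_cast e1
  have e4 : c' < c + 1 := by exact_mod_cast e2
  rw [h, h', show c = c' by omega]

theorem level_succ_subset {n i j : ℕ} (hi : i < P.cuts n) (hj : j < P.height n) :
    P.level (n + 1) (P.start n i + j) ⊆ P.level n j := by
  rintro x ⟨h1, h2⟩
  have hw := P.width_pos (n + 1)
  rw [P.left_succ hi hj] at h1 h2
  have h3 : (i : ℝ) + 1 ≤ P.cuts n := by exact_mod_cast hi
  refine ⟨le_trans (le_add_of_nonneg_right (by positivity)) h1, h2.trans_le ?_⟩
  rw [P.width_eq n]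
  nlinarith

theorem exists_mem_level_succ {n j : ℕ} (hj : j < P.height n) {x : ℝ≥0} (hx : x ∈ P.level n j) :
    ∃ i < P.cuts n, x ∈ P.level (n + 1) (P.start n i + j) := by
  have hw := P.width_pos (n + 1)
  obtain ⟨h1, h2⟩ := hx
  have h0 : 0 ≤ ((x : ℝ) - P.left n j) / P.width (n + 1) :=
    div_nonneg (sub_nonneg.2 h1) hw.le
  have hi : ⌊((x : ℝ) - P.left n j) / P.width (n + 1)⌋₊ < P.cuts n := by
    rw [Nat.floor_lt h0, div_lt_iff₀ hw, ← P.width_eq n]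
    linarith
  refine ⟨_, hi, ?_, ?_⟩
  · rw [P.left_succ hi hj]
    have := (le_div_iff₀ hw).1 (Nat.floor_le h0)
    linarith
  · rw [P.left_succ hi hj]
    have := (div_lt_iff₀ hw).1 (Nat.lt_floor_add_one (((x : ℝ) - P.left n j) / P.width (n + 1)))
    linarith

theorem left_bot (n : ℕ) : P.left n 0 = 0 ∧ 0 < P.height n := by
  induction n with
  | zero => exact ⟨by simp [left, column], by simp [height_zero]⟩
  | succ n ih =>
    have h := P.left_succ (P.cuts_pos n) ih.2
    have h2 := P.start_add_height_add_spacers_le (P.cuts_pos n)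
    simp only [start, Finset.range_zero, Finset.sum_empty, zero_add, Nat.cast_zero, zero_mul,
      add_zero] at h h2
    exact ⟨by rw [h, ih.1], by omega⟩

theorem height_pos (n : ℕ) : 0 < P.height n := (P.left_bot n).2

theorem start_zero (n : ℕ) : P.start n 0 = 0 := by simp [start]

/-- Levels of a column are cut into levels of later columns, by translating the whole column. -/
theorem exists_mem_level_of_le {n m j : ℕ} (hnm : n ≤ m) (hj : j < P.height n) {x : ℝ≥0}
    (hx : x ∈ P.level n j) :
    ∃ o, x ∈ P.level m (o + j) ∧
      ∀ t < P.height n, o + t < P.height m ∧ P.level m (o + t) ⊆ P.level n t := by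
  induction m, hnm using Nat.le_induction with
  | base => exact ⟨0, by simpa using hx, fun t ht => by simpa using ht⟩
  | succ m hnm ih =>
    obtain ⟨o, ho, hot⟩ := ih
    obtain ⟨i, hi, hxi⟩ := P.exists_mem_level_succ (hot j hj).1 ho
    refine ⟨P.start m i + o, by rwa [add_assoc], fun t ht => ⟨?_, ?_⟩⟩
    · have := P.start_add_height_add_spacers_le hi
      have := (hot t ht).1
      omega
    · rw [add_assoc]
      exact (P.level_succ_subset hi (hot t ht).1).trans (hot t ht).2

theorem columnMapsTo_iff {n : ℕ} {x y : ℝ} : P.ColumnMapsTo n x y ↔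
    ∃ j, j + 1 < P.height n ∧ x ∈ Ico (P.left n j) (P.left n j + P.width n) ∧
      y = x - P.left n j + P.left n (j + 1) := by
  unfold ColumnMapsTo left height
  constructor
  · rintro ⟨i, h, hx, hy⟩
    refine ⟨i, h, ?_, ?_⟩
    · rwa [List.getD_eq_getElem _ _ (by omega)]
    · rwa [List.getD_eq_getElem _ _ (by omega), List.getD_eq_getElem _ _ h]
  · rintro ⟨i, h, hx, hy⟩
    refine ⟨i, h, ?_, ?_⟩
    · rwa [List.getD_eq_getElem _ _ (by omega)] at hx
    · rwa [List.getD_eq_getElem _ _ (by omega), List.getD_eq_getElem _ _ h] at hy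

end CuttingParams

/-! ### Lebesgue measure of levels and existence of the limit map -/

theorem lebesgueHalfLine_apply (A : Set ℝ≥0) :
    lebesgueHalfLine A = volume (((↑) : ℝ≥0 → ℝ) '' A) :=
  (MeasurableEmbedding.subtype_coe measurableSet_Ici).comap_apply _ _

theorem lebesgueHalfLine_eq_of_image_add {A B : Set ℝ≥0} (d : ℝ)
    (h : (fun x : ℝ => x + d) '' (((↑) : ℝ≥0 → ℝ) '' A) = ((↑) : ℝ≥0 → ℝ) '' B) :
    lebesgueHalfLine A = lebesgueHalfLine B := by
  rw [lebesgueHalfLine_apply, lebesgueHalfLine_apply, ← h, image_add_right, measure_preimage_add_right]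

instance : IsLocallyFiniteMeasure lebesgueHalfLine := by
  refine ⟨fun x => ⟨Iio (x + 1), Iio_mem_nhds (by simp), ?_⟩⟩
  rw [lebesgueHalfLine_apply]
  refine (measure_mono (?_ : _ ⊆ Icc (0 : ℝ) (x + 1))).trans_lt measure_Icc_lt_top
  rintro _ ⟨y, hy, rfl⟩
  exact ⟨y.2, by exact_mod_cast (mem_Iio.1 hy).le⟩

namespace CuttingParams

variable (P : CuttingParams)

theorem measurableSet_level (n j : ℕ) : MeasurableSet (P.level n j) :=
  measurableSet_Ico.preimage measurable_subtype_coe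

theorem image_level {n j : ℕ} (hj : j < P.height n) :
    ((↑) : ℝ≥0 → ℝ) '' P.level n j = Ico (P.left n j) (P.left n j + P.width n) := by
  ext x
  constructor
  · rintro ⟨y, hy, rfl⟩; exact hy
  · exact fun hx => ⟨⟨x, (P.left_nonneg hj).trans hx.1⟩, hx, rfl⟩

theorem lebesgueHalfLine_level {n j : ℕ} (hj : j < P.height n) :
    lebesgueHalfLine (P.level n j) = ENNReal.ofReal (P.width n) := by
  rw [lebesgueHalfLine_apply, P.image_level hj, Real.volume_Ico, add_sub_cancel_left]

variable {P}

theorem columnMapsTo_nnreal_iff {n : ℕ} {x y : ℝ≥0} : P.ColumnMapsTo n x y ↔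
    ∃ j, j + 1 < P.height n ∧ x ∈ P.level n j ∧
      (y : ℝ) = x - P.left n j + P.left n (j + 1) :=
  P.columnMapsTo_iff

theorem ColumnMapsTo.succ {n : ℕ} {x y : ℝ≥0} (h : P.ColumnMapsTo n x y) :
    P.ColumnMapsTo (n + 1) x y := by
  obtain ⟨j, hj, hx, hy⟩ := columnMapsTo_nnreal_iff.1 h
  obtain ⟨i, hi, hxi⟩ := P.exists_mem_level_succ (by omega) hx
  have := P.start_add_height_add_spacers_le hi
  refine columnMapsTo_nnreal_iff.2 ⟨P.start n i + j, by omega, hxi, ?_⟩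
  rw [add_assoc, P.left_succ hi hj, P.left_succ hi (by omega), hy]
  ring

theorem ColumnMapsTo.mono {n m : ℕ} (hnm : n ≤ m) {x y : ℝ≥0} (h : P.ColumnMapsTo n x y) :
    P.ColumnMapsTo m x y := by
  induction m, hnm using Nat.le_induction with
  | base => exact h
  | succ m _ ih => exact ih.succ

theorem ColumnMapsTo.unique {n : ℕ} {x y z : ℝ≥0} (h : P.ColumnMapsTo n x y)
    (h' : P.ColumnMapsTo n x z) : y = z := by
  obtain ⟨j, hj, hx, hy⟩ := columnMapsTo_nnreal_iff.1 h
  obtain ⟨j', hj', hx', hz⟩ := columnMapsTo_nnreal_iff.1 h'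
  obtain rfl := P.level_unique (by omega) (by omega) hx hx'
  exact NNReal.coe_injective (hy.trans hz.symm)

/-- If there is always a spacer on the last subcolumn, the limit of the column maps is defined
everywhere. -/
theorem exists_generates
    (hlim : Tendsto (fun n => (P.height n : ℝ) * P.width n) atTop atTop)
    (hsp : ∀ n, 0 < P.spacers n (P.cuts n - 1)) : ∃ S, P.Generates S := by
  have hex : ∀ x : ℝ≥0, ∃ y : ℝ≥0, ∃ n, P.ColumnMapsTo n x y := by
    intro x
    obtain ⟨n, hn⟩ := (hlim.eventually_gt_atTop (x : ℝ)).exists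
    obtain ⟨j, hj, hx⟩ := P.exists_mem_level hn
    obtain ⟨i, hi, hxi⟩ := P.exists_mem_level_succ hj hx
    have hlt : P.start n i + j + 1 < P.height (n + 1) := by
      have hc := P.cuts_pos n
      have h1 := P.start_add_height_add_spacers_le (i := P.cuts n - 1) (n := n) (by omega)
      have h2 := P.start_mono n (a := i) (b := P.cuts n - 1) (by omega)
      have := hsp n
      omega
    have h0 : 0 ≤ (x : ℝ) - P.left (n + 1) (P.start n i + j) +
        P.left (n + 1) (P.start n i + j + 1) :=
      add_nonneg (sub_nonneg.2 hxi.1) (P.left_nonneg hlt)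
    exact ⟨⟨_, h0⟩, n + 1, columnMapsTo_nnreal_iff.2 ⟨_, hlt, hxi, rfl⟩⟩
  choose S n hS using hex
  exact ⟨S, hlim, fun x => eventually_atTop.2 ⟨n x, fun m hm => (hS x).mono hm⟩⟩

/-! ### The limit map is invertible and measure preserving -/

namespace Generates

variable {S : ℝ≥0 → ℝ≥0} (hS : P.Generates S)
include hS

theorem tendsto_height : Tendsto (fun n => (P.height n : ℝ) * P.width n) atTop atTop := hS.1

theorem coe_apply {n j : ℕ} (hj : j + 1 < P.height n) {x : ℝ≥0} (hx : x ∈ P.level n j) :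
    (S x : ℝ) = x - P.left n j + P.left n (j + 1) := by
  have h0 : 0 ≤ (x : ℝ) - P.left n j + P.left n (j + 1) :=
    add_nonneg (sub_nonneg.2 hx.1) (P.left_nonneg hj)
  obtain ⟨m, hm⟩ := ((hS.2 x).and (eventually_ge_atTop n)).exists
  have := (columnMapsTo_nnreal_iff.2 ⟨j, hj, hx, rfl⟩ :
    P.ColumnMapsTo n x (⟨_, h0⟩ : ℝ≥0)).mono hm.2
  rw [ColumnMapsTo.unique hm.1 this]
  rfl

theorem apply_mem_level {n j : ℕ} (hj : j + 1 < P.height n) {x : ℝ≥0} (hx : x ∈ P.level n j) :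
    S x ∈ P.level n (j + 1) := by
  have h := hS.coe_apply hj hx
  obtain ⟨h1, h2⟩ := hx
  constructor <;> linarith

/-- In a later column every copy of level `j + 1` has a copy of level `j` directly beneath it, so
nothing else can enter level `j + 1`. -/
theorem preimage_level_succ {n j : ℕ} (hj : j + 1 < P.height n) :
    S ⁻¹' P.level n (j + 1) = P.level n j := by
  refine Subset.antisymm (fun x hx => ?_) fun x hx => hS.apply_mem_level hj hx
  obtain ⟨m, hm, hnm⟩ := ((hS.2 x).and (eventually_ge_atTop n)).exists
  obtain ⟨q, hq, hxq, -⟩ := columnMapsTo_nnreal_iff.1 hm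
  obtain ⟨o, ho, hot⟩ := P.exists_mem_level_of_le hnm hj hx
  have := P.level_unique hq (hot _ hj).1 (hS.apply_mem_level hq hxq) ho
  obtain rfl : q = o + j := by omega
  exact (hot j (by omega)).2 hxq

theorem iterate_mem_level {n j N : ℕ} (hj : j + N < P.height n) {x : ℝ≥0}
    (hx : x ∈ P.level n j) : S^[N] x ∈ P.level n (j + N) := by
  induction N with
  | zero => simpa using hx
  | succ N ih =>
    rw [Function.iterate_succ_apply']
    exact hS.apply_mem_level hj (ih (by omega))

theorem preimage_iterate_level {n j N : ℕ} (hj : j + N < P.height n) :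
    S^[N] ⁻¹' P.level n (j + N) = P.level n j := by
  induction N with
  | zero => simp
  | succ N ih =>
    rw [Function.iterate_succ', preimage_comp, ← add_assoc,
      hS.preimage_level_succ (by omega), ih (by omega)]

theorem eventually_exists_mem_level (x : ℝ≥0) :
    ∀ᶠ n in atTop, ∃ j, j + 1 < P.height n ∧ x ∈ P.level n j :=
  (hS.2 x).mono fun _ h => by
    obtain ⟨j, hj, hx, -⟩ := columnMapsTo_nnreal_iff.1 h
    exact ⟨j, hj, hx⟩

theorem injective : Function.Injective S := by
  intro x y hxy
  obtain ⟨n, ⟨j, hj, hx⟩, j', hj', hy⟩ :=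
    ((hS.eventually_exists_mem_level x).and (hS.eventually_exists_mem_level y)).exists
  have h := P.level_unique hj hj' (hS.apply_mem_level hj hx)
    (hxy ▸ hS.apply_mem_level hj' hy)
  obtain rfl : j = j' := by omega
  have h1 := hS.coe_apply hj hx
  have h2 := hS.coe_apply hj hy
  rw [hxy] at h1
  exact NNReal.coe_injective (by linarith)

theorem measurable : Measurable S := by
  intro B hB
  have : S ⁻¹' B = ⋃ (n : ℕ) (j ∈ Finset.range (P.height n - 1)), P.level n j ∩
      (fun x : ℝ≥0 => ((x : ℝ) - P.left n j + P.left n (j + 1)).toNNReal) ⁻¹' B := by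
    ext x
    simp only [mem_iUnion, mem_inter_iff, mem_preimage, Finset.mem_range, exists_prop]
    constructor
    · intro hx
      obtain ⟨n, j, hj, hxj⟩ := (hS.eventually_exists_mem_level x).exists
      refine ⟨n, j, by omega, hxj, ?_⟩
      rwa [← hS.coe_apply hj hxj, Real.toNNReal_coe]
    · rintro ⟨n, j, hj, hxj, hx⟩
      rwa [← hS.coe_apply (by omega) hxj, Real.toNNReal_coe] at hx
  rw [this]
  refine MeasurableSet.iUnion fun n => Finset.measurableSet_biUnion _ fun j _ => ?_
  have hm : Measurable fun x : ℝ≥0 => ((x : ℝ) - P.left n j + P.left n (j + 1)).toNNReal := by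
    fun_prop
  exact (P.measurableSet_level n j).inter (hm hB)

theorem lebesgueHalfLine_preimage_inter_level {n j : ℕ} (hj : j + 1 < P.height n) (B : Set ℝ≥0) :
    lebesgueHalfLine (S ⁻¹' B ∩ P.level n j) = lebesgueHalfLine (B ∩ P.level n (j + 1)) := by
  refine lebesgueHalfLine_eq_of_image_add (P.left n (j + 1) - P.left n j) ?_
  rw [image_image]
  ext y
  constructor
  · rintro ⟨x, ⟨hxB, hx⟩, rfl⟩
    refine ⟨S x, ⟨hxB, hS.apply_mem_level hj hx⟩, ?_⟩
    rw [hS.coe_apply hj hx]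
    ring
  · rintro ⟨z, ⟨hzB, hz⟩, rfl⟩
    have h0 : 0 ≤ (z : ℝ) - P.left n (j + 1) + P.left n j :=
      add_nonneg (sub_nonneg.2 hz.1) (P.left_nonneg (by omega))
    obtain ⟨x, hxe⟩ : ∃ x : ℝ≥0, (x : ℝ) = z - P.left n (j + 1) + P.left n j := ⟨⟨_, h0⟩, rfl⟩
    have hx : x ∈ P.level n j := by
      obtain ⟨h1, h2⟩ := hz
      refine ⟨?_, ?_⟩ <;> rw [hxe] <;> linarith
    have hSx : S x = z := by
      refine NNReal.coe_injective ?_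
      rw [hS.coe_apply hj hx, hxe]
      ring
    refine ⟨x, ⟨?_, hx⟩, ?_⟩
    · rwa [mem_preimage, hSx]
    · simp only [hxe]; ring

theorem measurePreserving : MeasurePreserving S lebesgueHalfLine lebesgueHalfLine := by
  refine ⟨hS.measurable, Measure.ext fun B hB => ?_⟩
  rw [Measure.map_apply hS.measurable hB]
  -- `V n` omits the top level and `W n` the bottom one; `S` carries `V n` to `W n` by translations.
  -- The `V n` exhaust the half-line and the `W n` exhaust it up to the point `0`, which always
  -- stays in the bottom level.
  let V : ℕ → Set ℝ≥0 := fun n => ⋃ j ∈ Finset.range (P.height n - 1), P.level n j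
  let W : ℕ → Set ℝ≥0 := fun n => ⋃ j ∈ Finset.range (P.height n - 1), P.level n (j + 1)
  have hVmem : ∀ n x, x ∈ V n ↔ ∃ j, j + 1 < P.height n ∧ x ∈ P.level n j := fun n x => by
    simp only [V, mem_iUnion, Finset.mem_range, exists_prop, Nat.lt_sub_iff_add_lt]
  have hWmem : ∀ n x, x ∈ W n ↔ ∃ j, j + 1 < P.height n ∧ x ∈ P.level n (j + 1) := fun n x => by
    simp only [W, mem_iUnion, Finset.mem_range, exists_prop, Nat.lt_sub_iff_add_lt]
  have hVmono : Monotone V := by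
    intro n m hnm x hx
    obtain ⟨j, hj, hx⟩ := (hVmem n x).1 hx
    obtain ⟨o, ho, hot⟩ := P.exists_mem_level_of_le hnm (by omega) hx
    exact (hVmem m x).2 ⟨o + j, (hot _ hj).1, ho⟩
  have hWmono : Monotone W := by
    intro n m hnm x hx
    obtain ⟨j, hj, hx⟩ := (hWmem n x).1 hx
    obtain ⟨o, ho, hot⟩ := P.exists_mem_level_of_le hnm hj hx
    exact (hWmem m x).2 ⟨o + j, (hot _ hj).1, ho⟩
  have hV : ⋃ n, V n = univ := eq_univ_of_forall fun x => by
    obtain ⟨n, hn⟩ := (hS.eventually_exists_mem_level x).exists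
    exact mem_iUnion.2 ⟨n, (hVmem n x).2 hn⟩
  have hW : ({0} : Set ℝ≥0)ᶜ ⊆ ⋃ n, W n := by
    intro x hx
    have hx0 : 0 < (x : ℝ) := NNReal.coe_pos.2 (pos_iff_ne_zero.2 hx)
    obtain ⟨n, ⟨j, hj, hxj⟩, hn⟩ := ((hS.eventually_exists_mem_level x).and
      (P.tendsto_width.eventually_lt_const hx0)).exists
    refine mem_iUnion.2 ⟨n, (hWmem n x).2 ?_⟩
    cases j with
    | zero =>
      have := hxj.2
      rw [(P.left_bot n).1] at this
      linarith
    | succ j => exact ⟨j, by omega, hxj⟩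
  have hVW : ∀ n, lebesgueHalfLine (S ⁻¹' B ∩ V n) = lebesgueHalfLine (B ∩ W n) := by
    intro n
    have hdis : ∀ d, d ≤ 1 → (↑(Finset.range (P.height n - 1)) : Set ℕ).PairwiseDisjoint
        fun j => P.level n (j + d) := by
      intro d hd i hi j hj hij
      rw [Finset.coe_range, mem_Iio] at hi hj
      refine disjoint_left.2 fun x hx hx' => hij ?_
      have := P.level_unique (by omega) (by omega) hx hx'
      omega
    simp only [V, W, inter_iUnion₂]
    rw [measure_biUnion_finset, measure_biUnion_finset]
    · refine Finset.sum_congr rfl fun j hj => ?_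
      rw [Finset.mem_range] at hj
      exact hS.lebesgueHalfLine_preimage_inter_level (by omega) B
    · exact fun i hi j hj hij => (hdis 1 le_rfl hi hj hij).mono inter_subset_right inter_subset_right
    · exact fun j _ => hB.inter (P.measurableSet_level _ _)
    · exact fun i hi j hj hij => (hdis 0 zero_le_one hi hj hij).mono inter_subset_right inter_subset_right
    · exact fun j _ => (hS.measurable hB).inter (P.measurableSet_level _ _)
  have h1 := tendsto_measure_iUnion_atTop (μ := lebesgueHalfLine) (s := fun n => S ⁻¹' B ∩ V n)
    fun n m h => inter_subset_inter_right _ (hVmono h)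
  have h2 := tendsto_measure_iUnion_atTop (μ := lebesgueHalfLine) (s := fun n => B ∩ W n)
    fun n m h => inter_subset_inter_right _ (hWmono h)
  rw [← inter_iUnion, hV, inter_univ] at h1
  rw [← inter_iUnion] at h2
  have h3 : lebesgueHalfLine (B ∩ ⋃ n, W n) = lebesgueHalfLine B := by
    refine le_antisymm (measure_mono inter_subset_left) ?_
    have h0 : lebesgueHalfLine {0} = 0 := by
      rw [lebesgueHalfLine_apply, image_singleton, Real.volume_singleton]
    calc lebesgueHalfLine B ≤ lebesgueHalfLine ((B ∩ ⋃ n, W n) ∪ {0}) := by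
          refine measure_mono fun x hx => ?_
          by_cases hx0 : x = 0
          · exact Or.inr hx0
          · exact Or.inl ⟨hx, hW hx0⟩
      _ ≤ _ := (measure_union_le _ _).trans (by rw [h0, add_zero])
  rw [h3] at h2
  refine tendsto_nhds_unique h1 (h2.congr fun n => ?_)
  exact (hVW n).symm

theorem isInvertibleNonsingular : IsInvertibleNonsingular S lebesgueHalfLine := by
  have hp := hS.measurePreserving
  obtain ⟨S', hS'm, hS'⟩ := (hS.measurable.measurableEmbedding hS.injective).exists_measurable_extend
    measurable_id fun x => ⟨x⟩
  refine ⟨hS.measurable, ⟨S', hS'm, Eventually.of_forall fun x => congrFun hS' x, ?_⟩, fun A hA => ?_⟩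
  · have hr : MeasurableSet (range S) :=
      (hS.measurable.measurableEmbedding hS.injective).measurableSet_range
    refine measure_mono_null (t := (range S)ᶜ) ?_ ?_
    · rintro x hx ⟨y, rfl⟩
      exact hx (congrArg S (congrFun hS' y))
    · rw [← hp.measure_preimage hr.compl.nullMeasurableSet]
      simp
  · rw [hp.measure_preimage hA.nullMeasurableSet]

end Generates

end CuttingParams

/-! ### Return times of the base and choice of the heights -/

namespace CuttingParams

variable (P : CuttingParams)

/-- The number of spacers of the `n`-th column that are not on the last subcolumn. -/
def innerSpacers (n : ℕ) : ℕ := ∑ l ∈ Finset.range (P.cuts n - 1), P.spacers n l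

/-- The number of levels of the `(n + 1)`-st column below the spacers on the last subcolumn. -/
noncomputable def reach (n : ℕ) : ℕ := P.cuts n * P.height n + P.innerSpacers n

theorem height_succ_eq_reach (n : ℕ) :
    P.height (n + 1) = P.reach n + P.spacers n (P.cuts n - 1) := by
  obtain ⟨c, hc⟩ : ∃ c, P.cuts n = c + 1 := ⟨P.cuts n - 1, by have := P.cuts_pos n; omega⟩
  rw [height_succ, reach, innerSpacers, hc, Nat.add_sub_cancel, Finset.sum_range_succ, add_assoc]

theorem start_add_height_le_reach {n i : ℕ} (hi : i < P.cuts n) :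
    P.start n i + P.height n ≤ P.reach n := by
  obtain ⟨c, hc⟩ : ∃ c, P.cuts n = c + 1 := ⟨P.cuts n - 1, by omega⟩
  refine (Nat.add_le_add_right (P.start_mono n (b := c) (by omega)) _).trans ?_
  rw [start_eq, reach, innerSpacers, hc, Nat.add_sub_cancel]
  exact le_of_eq (by ring)

theorem start_le_start_add {n i i' : ℕ} (h : i ≤ i') (hi' : i' < P.cuts n) :
    P.start n i + (i' - i) * P.height n ≤ P.start n i' ∧
      P.start n i' ≤ P.start n i + (i' - i) * P.height n + P.innerSpacers n := by
  obtain ⟨d, rfl⟩ := Nat.exists_eq_add_of_le h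
  rw [start_eq, start_eq, Nat.add_sub_cancel_left, add_mul]
  have h1 : ∑ l ∈ Finset.range i, P.spacers n l ≤ ∑ l ∈ Finset.range (i + d), P.spacers n l :=
    Finset.sum_le_sum_of_subset (Finset.range_subset_range.2 h)
  have h2 : ∑ l ∈ Finset.range (i + d), P.spacers n l ≤ P.innerSpacers n :=
    Finset.sum_le_sum_of_subset (Finset.range_subset_range.2 (by omega))
  omega

theorem height_lt_height_succ (n : ℕ) : P.height n < P.height (n + 1) := by
  have h1 := P.height_pos n
  have h2 : 2 * P.height n ≤ P.cuts n * P.height n := Nat.mul_le_mul_right _ (P.two_le_cuts n)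
  rw [height_succ]
  omega

theorem strictMono_height : StrictMono P.height := strictMono_nat_of_lt_succ P.height_lt_height_succ

theorem level_one_zero_subset : P.level 1 0 ⊆ P.level 0 0 := by
  have := P.level_succ_subset (P.cuts_pos 0) (P.height_pos 0)
  rwa [start_zero] at this

/-- Points of the base lie in column `0`, hence are never in a spacer added later. Their indices
stay below `reach`, a bound not involving the spacers on the last subcolumn. -/
theorem exists_mem_level_lt_reach {n q : ℕ} (hq : q < P.height (n + 1)) {x : ℝ≥0}
    (hx : x ∈ P.level 1 0) (hxq : x ∈ P.level (n + 1) q) :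
    ∃ a < P.height n, ∃ i < P.cuts n, x ∈ P.level n a ∧ q = P.start n i + a := by
  obtain ⟨o, ho, hot⟩ := P.exists_mem_level_of_le (Nat.zero_le n) (P.height_pos 0)
    (P.level_one_zero_subset hx)
  have hoa := (hot 0 (P.height_pos 0)).1
  obtain ⟨i, hi, hxi⟩ := P.exists_mem_level_succ hoa ho
  have := P.start_add_height_add_spacers_le hi
  exact ⟨_, hoa, i, hi, ho, P.level_unique hq (by omega) hxq hxi⟩

theorem lt_reach_of_mem_level {n q : ℕ} (hq : q < P.height (n + 1)) {x : ℝ≥0}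
    (hx : x ∈ P.level 1 0) (hxq : x ∈ P.level (n + 1) q) : q < P.reach n := by
  obtain ⟨a, ha, i, hi, -, rfl⟩ := P.exists_mem_level_lt_reach hq hx hxq
  have := P.start_add_height_le_reach hi
  omega

/-- The differences of the indices of the levels that make up `P.level 1 0` are close to multiples
of the heights of columns. -/
theorem exists_near_multiple {n q q' : ℕ} (hqq : q < q') (hq' : q' < P.height (n + 1))
    {x x' : ℝ≥0} (hx : x ∈ P.level 1 0) (hx' : x' ∈ P.level 1 0) (hxq : x ∈ P.level (n + 1) q)
    (hxq' : x' ∈ P.level (n + 1) q') :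
    ∃ m j, 1 ≤ j ∧ j ≤ P.cuts (m + 1) ∧
      j * P.height (m + 1) ≤ q' - q + (P.reach m + P.innerSpacers (m + 1)) ∧
      q' - q ≤ j * P.height (m + 1) + (P.reach m + P.innerSpacers (m + 1)) := by
  induction n generalizing q q' with
  | zero =>
    -- In column `1` the base is a single level, so two different indices are impossible. With
    -- `[0,1)` as base, the height of column `0`, which is fixed at `1`, would enter.
    have := P.level_unique hq' (P.height_pos _) hxq' hx'
    omega
  | succ n ih =>
    obtain ⟨a, ha, i, hi, hxa, rfl⟩ := P.exists_mem_level_lt_reach (hqq.trans hq') hx hxq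
    obtain ⟨a', ha', i', hi', hxa', rfl⟩ := P.exists_mem_level_lt_reach hq' hx' hxq'
    -- In different subcolumns the gap is `i' - i` heights up to inner spacers and the offsets `a`,
    -- `a'`; in the same subcolumn the question descends to the previous column.
    rcases lt_trichotomy i i' with h | rfl | h
    · have h1 := P.start_le_start_add h.le hi'
      have h2 := P.lt_reach_of_mem_level ha hx hxa
      have h3 := P.lt_reach_of_mem_level ha' hx' hxa'
      exact ⟨n, i' - i, by omega, by omega, by omega, by omega⟩
    · have := ih (by omega) ha' hxa hxa'
      rwa [Nat.add_sub_add_left]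
    · have h1 := P.start_mono (n + 1) (Nat.succ_le_of_lt h)
      rw [Nat.succ_eq_add_one, start_succ] at h1
      omega

/-- Return times of the bottom level of column `1` are close to multiples of the heights of
columns. -/
theorem Generates.return_time_near_multiple {P : CuttingParams} {S : ℝ≥0 → ℝ≥0}
    (hS : P.Generates S) (hsp : ∀ n, P.height n ≤ P.spacers n (P.cuts n - 1)) {N : ℕ} (hN : 1 ≤ N)
    {x : ℝ≥0} (hx : x ∈ P.level 1 0) (hx' : S^[N] x ∈ P.level 1 0) :
    ∃ m j, 1 ≤ j ∧ j ≤ P.cuts (m + 1) ∧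
      j * P.height (m + 1) ≤ N + (P.reach m + P.innerSpacers (m + 1)) ∧
      N ≤ j * P.height (m + 1) + (P.reach m + P.innerSpacers (m + 1)) := by
  -- Column `N + 1` has enough spacers on top for the first `N` iterates of a base point to climb
  -- inside it.
  have hNh : N ≤ P.height N := P.strictMono_height.id_le N
  obtain ⟨o, ho, hot⟩ := P.exists_mem_level_of_le (show 1 ≤ N + 1 by omega) (P.height_pos 1) hx
  have ho' := (hot 0 (P.height_pos 1)).1
  have h1 := P.lt_reach_of_mem_level ho' hx ho
  have h2 := P.height_succ_eq_reach N
  have h3 := hsp N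
  have hlt : o + 0 + N < P.height (N + 1) := by omega
  have := P.exists_near_multiple (show o + 0 < o + 0 + N by omega) hlt hx hx' ho
    (hS.iterate_mem_level hlt ho)
  rwa [Nat.add_sub_cancel_left] at this

/-- The spacers on the last subcolumns can be chosen so that the heights are large and have
prescribed properties, which may depend on what precedes. -/
theorem exists_height (r : ℕ → ℕ) (hr : ∀ n, 2 ≤ r n) (δ : ℕ → ℕ → ℕ) (G : ℕ → ℕ → ℕ → Prop)
    (hG : ∀ n M N, ∃ h ≥ N, G n M h) :
    ∃ P : CuttingParams, P.cuts = r ∧ (∀ n l, l + 1 < r n → P.spacers n l = δ n l) ∧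
      (∀ n, r n * P.height n < P.spacers n (P.cuts n - 1)) ∧
      ∀ n, G (n + 1) (P.reach n + P.innerSpacers (n + 1)) (P.height (n + 1)) := by
  choose g hg1 hg2 using hG
  -- The window radius involves only `H n` and inner spacers, so `H (n + 1)` may be chosen after it.
  -- The lower bound leaves more than `r n * H n` spacers for the last subcolumn.
  let e : ℕ → ℕ := fun n => ∑ l ∈ Finset.range (r n - 1), δ n l
  let H : ℕ → ℕ := fun n => Nat.rec 1
    (fun n h => g (n + 1) (r n * h + e n + e (n + 1)) (2 * (r n * h) + e n + 1)) n
  have H_succ : ∀ n, H (n + 1) =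
      g (n + 1) (r n * H n + e n + e (n + 1)) (2 * (r n * H n) + e n + 1) := fun _ => rfl
  let P : CuttingParams := ⟨r, fun n l => if l + 1 < r n then δ n l else
    H (n + 1) - (r n * H n + e n), hr⟩
  have hsp : ∀ n l, l + 1 < r n → P.spacers n l = δ n l := fun n l h => if_pos h
  have hlast : ∀ n, P.spacers n (P.cuts n - 1) = H (n + 1) - (r n * H n + e n) := fun n =>
    if_neg (by have := hr n; simp only [P]; omega)
  have hinner : ∀ n, P.innerSpacers n = e n := fun n =>
    Finset.sum_congr rfl fun l hl => hsp n l (by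
      have : l < r n - 1 := Finset.mem_range.1 hl
      omega)
  have hHle : ∀ n, 2 * (r n * H n) + e n + 1 ≤ H (n + 1) := fun n => by
    rw [H_succ]; exact hg1 _ _ _
  have hH : ∀ n, P.height n = H n := by
    intro n
    induction n with
    | zero => rfl
    | succ n ih =>
      have := hHle n
      have h2 : P.cuts n = r n := rfl
      rw [P.height_succ_eq_reach, reach, hinner, hlast, ih, h2]
      omega
  refine ⟨P, rfl, hsp, fun n => ?_, fun n => ?_⟩
  · have := hHle n
    rw [hlast, hH]
    omega
  · rw [reach, hinner, hinner, hH, hH, H_succ]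
    exact hg2 _ _ _

/-- The spacers on the last subcolumn at least double the measure at each stage. -/
theorem tendsto_height_mul_width (hsp : ∀ n, P.cuts n * P.height n ≤ P.spacers n (P.cuts n - 1)) :
    Tendsto (fun n => (P.height n : ℝ) * P.width n) atTop atTop := by
  refine tendsto_atTop_mono (fun n => ?_) (tendsto_pow_atTop_atTop_of_one_lt (one_lt_two (α := ℝ)))
  induction n with
  | zero => simp [height_zero, width_zero]
  | succ n ih =>
    have h1 : 2 * (P.cuts n * P.height n) ≤ P.height (n + 1) := by
      have := hsp n
      rw [height_succ_eq_reach, reach]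
      omega
    have h2 : 2 * ((P.cuts n : ℝ) * P.height n) ≤ P.height (n + 1) := by exact_mod_cast h1
    have h3 := P.width_pos (n + 1)
    rw [P.width_eq n] at ih
    rw [pow_succ]
    nlinarith

end CuttingParams

/-! ### Sets without common return times and wandering boxes -/

open CuttingParams

/-- Given the numbers of cuts and the spacers on all subcolumns but the last ones, the remaining
spacers can be chosen so that the bottom level of column `1` never returns to itself at the same
time as a certain set of positive measure does under `T`. -/
theorem exists_generates_disjoint_return_times {X : Type*} [MeasurableSpace X] (μ : Measure X)
    [SigmaFinite μ] (T : X → X) (hT : IsInvertibleNonsingular T μ)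
    (hfin : ¬ HasFiniteInvariantMeasure T μ) (r : ℕ → ℕ) (hr : ∀ n, 2 ≤ r n) (δ : ℕ → ℕ → ℕ) :
    ∃ P : CuttingParams, P.cuts = r ∧ (∀ n l, l + 1 < r n → P.spacers n l = δ n l) ∧
      ∃ S, P.Generates S ∧ ∃ A, MeasurableSet A ∧ μ A ≠ 0 ∧
        ∀ N, 1 ≤ N → ∀ x ∈ P.level 1 0, S^[N] x ∈ P.level 1 0 → ∀ a ∈ A, T^[N] a ∉ A := by
  -- Only the measure class matters, so `μ` may be replaced by an equivalent finite measure.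
  have hac : μ ≪ μ.toFinite := absolutelyContinuous_toFinite μ
  have hca : μ.toFinite ≪ μ := toFinite_absolutelyContinuous μ
  obtain ⟨B, hB, hB0, hBf⟩ := exists_frequently_cesaroPreimage_lt (m := μ.toFinite) hT.measurable
    (fun A hA => by
      rw [toFinite_apply_eq_zero_iff, toFinite_apply_eq_zero_iff]; exact hT.null_iff A hA)
    (fun ⟨ν, h1, h2, h3, h4⟩ => hfin ⟨ν, h1, h2.trans hca, hac.trans h3, h4⟩)
  obtain ⟨ε, hε, hεsum⟩ := ENNReal.exists_pos_sum_of_countable hB0 ℕ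
  -- `c n M` counts the pairs of a multiplier and an offset, so each stage removes at most `ε n`.
  -- The shift `n - 1` in `G` occurs because the height chosen at stage `m` is that of column `m +
  -- 1`.
  let c : ℕ → ℕ → ℕ := fun n M => r (n + 1) * (2 * M + 1)
  have hc : ∀ n M, (c n M : ℝ≥0∞) ≠ 0 := fun n M => by
    have : 0 < c n M := Nat.mul_pos (by have := hr (n + 1); omega) (by omega)
    exact_mod_cast this.ne'
  let G : ℕ → ℕ → ℕ → Prop := fun n M h => ∀ j, 1 ≤ j → j ≤ r n → ∀ N, j * h ≤ N + M →
    N ≤ j * h + M → μ.toFinite (T^[N] ⁻¹' B) < ε (n - 1) / c (n - 1) M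
  obtain ⟨P, hPr, hPδ, hPsp, hPG⟩ := exists_height r hr δ G fun n M N =>
    exists_lt_near_multiples hBf
      (ENNReal.div_pos (by exact_mod_cast (hε _).ne') (ENNReal.natCast_ne_top _)) (r n) M N
  have hsp' : ∀ n, P.cuts n * P.height n ≤ P.spacers n (P.cuts n - 1) := fun n => by
    rw [hPr]; have := (hPsp n).le; rwa [hPr] at this
  obtain ⟨S, hS⟩ := exists_generates (P.tendsto_height_mul_width hsp') fun n =>
    (Nat.zero_le _).trans_lt (hPsp n)
  refine ⟨P, hPr, hPδ, S, hS, ?_⟩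
  let M : ℕ → ℕ := fun m => P.reach m + P.innerSpacers (m + 1)
  let F : ℕ → Finset (ℕ × ℕ) := fun m => Finset.Icc 1 (r (m + 1)) ×ˢ Finset.range (2 * M m + 1)
  let V : ℕ → Set X := fun m => ⋃ p ∈ F m, T^[p.1 * P.height (m + 1) + p.2 - M m] ⁻¹' B
  have hVm : ∀ m, MeasurableSet (V m) := fun m =>
    Finset.measurableSet_biUnion _ fun p _ => hT.measurable.iterate _ hB
  have hV : ∀ m, μ.toFinite (V m) ≤ ε m := by
    intro m
    calc μ.toFinite (V m)
        ≤ ∑ p ∈ F m, μ.toFinite (T^[p.1 * P.height (m + 1) + p.2 - M m] ⁻¹' B) :=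
          measure_biUnion_finset_le _ _
      _ ≤ ∑ _p ∈ F m, (ε m : ℝ≥0∞) / c m (M m) := Finset.sum_le_sum fun p hp => by
          simp only [F, Finset.mem_product, Finset.mem_Icc, Finset.mem_range] at hp
          exact (hPG m p.1 hp.1.1 hp.1.2 _ (by simp only [M]; omega)
            (by simp only [M] at hp ⊢; omega)).le
      _ = c m (M m) * ((ε m : ℝ≥0∞) / c m (M m)) := by simp [F, c]
      _ = ε m := ENNReal.mul_div_cancel (hc _ _) (ENNReal.natCast_ne_top _)
  refine ⟨B \ ⋃ m, V m, hB.diff (MeasurableSet.iUnion hVm), fun h0 => ?_, ?_⟩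
  · have : μ.toFinite B ≤ ∑' m, (ε m : ℝ≥0∞) := by
      calc μ.toFinite B ≤ μ.toFinite ((B \ ⋃ m, V m) ∪ ⋃ m, V m) :=
            measure_mono (by rw [sdiff_union_self]; exact subset_union_left)
        _ ≤ μ.toFinite (B \ ⋃ m, V m) + μ.toFinite (⋃ m, V m) := measure_union_le _ _
        _ ≤ 0 + ∑' m, (ε m : ℝ≥0∞) := by
            gcongr
            · exact (hca h0).le
            · exact (measure_iUnion_le _).trans (ENNReal.tsum_le_tsum hV)
        _ = _ := zero_add _
    exact absurd hεsum this.not_gt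
  · intro N hN x hx hNx a ha haN
    obtain ⟨m, j, hj1, hj2, hj3, hj4⟩ := hS.return_time_near_multiple (fun n =>
      (Nat.le_mul_of_pos_left _ (P.cuts_pos n)).trans (hsp' n)) hN hx hNx
    rw [hPr] at hj2
    refine ha.2 (mem_iUnion.2 ⟨m, mem_iUnion₂.2 ⟨(j, N + M m - j * P.height (m + 1)), ?_, ?_⟩⟩)
    · simp only [F, Finset.mem_product, Finset.mem_Icc, Finset.mem_range]
      simp only [M]
      omega
    · have : j * P.height (m + 1) + (N + M m - j * P.height (m + 1)) - M m = N := by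
        simp only [M]; omega
      rw [mem_preimage, this]
      exact haN.1

theorem IsInvertibleNonsingular.exists_inverse {X : Type*} [MeasurableSpace X] {T : X → X}
    {μ : Measure X} (hT : IsInvertibleNonsingular T μ) :
    ∃ T' : X → X, Measure.QuasiMeasurePreserving T' μ μ ∧ (∀ᵐ x ∂μ, T' (T x) = x) ∧
      ∀ᵐ x ∂μ, T (T' x) = x := by
  obtain ⟨T', hT'm, h1, h2⟩ := hT.invertible
  refine ⟨T', ⟨hT'm, Measure.AbsolutelyContinuous.mk fun s hs h => ?_⟩, h1, h2⟩
  rw [Measure.map_apply hT'm hs, ← hT.null_iff _ (hT'm hs), ← preimage_comp]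
  refine measure_mono_null (t := s ∪ {x | ¬T' (T x) = x}) (fun x hx => ?_) ?_
  · by_cases h' : T' (T x) = x
    · left; rw [mem_preimage, Function.comp_apply, h'] at hx; exact hx
    · exact Or.inr h'
  · exact measure_union_null h h1

/-- If the union of two disjoint sets of positive measure is wandering, then an invertible map is
not ergodic. -/
theorem not_quasiErgodic_of_wandering {Z : Type*} [MeasurableSpace Z] {ρ : Measure Z} {R R' : Z → Z}
    (hR' : Measure.QuasiMeasurePreserving R' ρ ρ) (h1 : ∀ᵐ z ∂ρ, R' (R z) = z)
    (h2 : ∀ᵐ z ∂ρ, R (R' z) = z) {V W : Set Z} (hV : MeasurableSet V) (hV0 : ρ V ≠ 0)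
    (hW0 : ρ W ≠ 0) (hVW : Disjoint V W)
    (hwan : ∀ N, 1 ≤ N → ∀ z ∈ V ∪ W, R^[N] z ∉ V ∪ W) : ¬ QuasiErgodic R ρ := by
  intro hR
  -- The two-sided saturation of `V` is invariant modulo null sets. It contains `V`, and it misses
  -- `W` almost everywhere, since otherwise an orbit would visit `V ∪ W` twice.
  let s : Set Z := (⋃ n : ℕ, R^[n] ⁻¹' V) ∪ ⋃ n : ℕ, R'^[n] ⁻¹' V
  have hs : MeasurableSet s :=
    (MeasurableSet.iUnion fun n => hR.measurable.iterate n hV).union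
      (MeasurableSet.iUnion fun n => hR'.measurable.iterate n hV)
  have hinv : R ⁻¹' s =ᵐ[ρ] s := by
    filter_upwards [h1] with z hz
    refine propext ⟨?_, ?_⟩
    · rintro (h | h)
      · obtain ⟨n, hn⟩ := mem_iUnion.1 h
        exact Or.inl (mem_iUnion.2 ⟨n + 1, hn⟩)
      · obtain ⟨n, hn⟩ := mem_iUnion.1 h
        cases n with
        | zero => exact Or.inl (mem_iUnion.2 ⟨1, hn⟩)
        | succ n =>
          rw [mem_preimage, Function.iterate_succ_apply, hz] at hn
          exact Or.inr (mem_iUnion.2 ⟨n, hn⟩)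
    · have hback : ∀ n, R'^[n] z ∈ V → R z ∈ s := fun n hn => by
        refine Or.inr (mem_iUnion.2 ⟨n + 1, ?_⟩)
        rwa [mem_preimage, Function.iterate_succ_apply, hz]
      rintro (h | h)
      · obtain ⟨n, hn⟩ := mem_iUnion.1 h
        cases n with
        | zero => exact hback 0 hn
        | succ n => exact Or.inl (mem_iUnion.2 ⟨n, hn⟩)
      · obtain ⟨n, hn⟩ := mem_iUnion.1 h
        exact hback n hn
  have hRR' : ∀ n : ℕ, ∀ᵐ z ∂ρ, R^[n] (R'^[n] z) = z := by
    intro n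
    induction n with
    | zero => exact Eventually.of_forall fun _ => rfl
    | succ n ih =>
      filter_upwards [ih, (hR'.iterate n).ae h2] with z hz hz2
      rw [Function.iterate_succ_apply, Function.iterate_succ_apply' R', hz2, hz]
  rcases hR.ae_empty_or_univ₀ hs.nullMeasurableSet hinv with h | h
  · refine hV0 (measure_mono_null ?_ (ae_eq_empty.1 h))
    exact fun z hz => Or.inl (mem_iUnion.2 ⟨0, hz⟩)
  · have hae : ∀ᵐ z ∂ρ, z ∉ W := by
      filter_upwards [h, ae_all_iff.2 hRR'] with z hzs hz' hz
      obtain hzs | hzs : z ∈ s := of_eq_true hzs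
      · obtain ⟨n, hn⟩ := mem_iUnion.1 hzs
        cases n with
        | zero => exact disjoint_left.1 hVW hn hz
        | succ n => exact hwan (n + 1) (by omega) z (Or.inr hz) (Or.inl hn)
      · obtain ⟨n, hn⟩ := mem_iUnion.1 hzs
        cases n with
        | zero => exact disjoint_left.1 hVW hn hz
        | succ n =>
          refine hwan (n + 1) (by omega) _ (Or.inl hn) (Or.inr ?_)
          rwa [hz' (n + 1)]
    exact hW0 (by simpa [ae_iff] using hae)

/-- If a set of positive measure and the bottom level of column `1` have no common return time,
then the product is neither conservative nor ergodic. -/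
theorem CuttingParams.Generates.not_conservative_not_quasiErgodic {X : Type*} [MeasurableSpace X]
    {μ : Measure X} [SigmaFinite μ] {T : X → X} (hT : IsInvertibleNonsingular T μ)
    {P : CuttingParams} {S : ℝ≥0 → ℝ≥0} (hS : P.Generates S) {A : Set X} (hA : MeasurableSet A)
    (hA0 : μ A ≠ 0)
    (hAS : ∀ N, 1 ≤ N → ∀ x ∈ P.level 1 0, S^[N] x ∈ P.level 1 0 → ∀ a ∈ A, T^[N] a ∉ A) :
    ¬ Conservative (Prod.map T S) (μ.prod lebesgueHalfLine) ∧
      ¬ QuasiErgodic (Prod.map T S) (μ.prod lebesgueHalfLine) := by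
  have hwan : ∀ N, 1 ≤ N → ∀ z ∈ A ×ˢ P.level 1 0, (Prod.map T S)^[N] z ∉ A ×ˢ P.level 1 0 := by
    rintro N hN ⟨a, x⟩ ⟨ha, hx⟩ h
    rw [Prod.map_iterate] at h
    exact hAS N hN x hx h.2 a ha h.1
  have hlev : ∀ n j, j < P.height n → (μ.prod lebesgueHalfLine) (A ×ˢ P.level n j) ≠ 0 := by
    intro n j hj
    rw [Measure.prod_prod, P.lebesgueHalfLine_level hj]
    exact mul_ne_zero hA0 (ENNReal.ofReal_pos.2 (P.width_pos n)).ne'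
  have hc0 := P.cuts_pos 1
  have hc1 : 1 < P.cuts 1 := P.two_le_cuts 1
  have hl0 : _ ≤ P.height 2 := P.start_add_height_add_spacers_le hc0
  have hl1 : _ ≤ P.height 2 := P.start_add_height_add_spacers_le hc1
  have hh := P.height_pos 1
  have hlt : P.start 1 0 < P.start 1 1 := by rw [P.start_succ]; omega
  -- The wandering box contains two disjoint boxes of positive measure, over two copies of the base
  -- in column `2`.
  have hsub : A ×ˢ P.level 2 (P.start 1 0 + 0) ∪ A ×ˢ P.level 2 (P.start 1 1 + 0) ⊆
      A ×ˢ P.level 1 0 :=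
    union_subset (prod_mono_right (P.level_succ_subset hc0 hh))
      (prod_mono_right (P.level_succ_subset hc1 hh))
  constructor
  · intro h
    obtain ⟨z, hz, N, hN, hzN⟩ := h.exists_mem_iterate_mem' (hA.prod (P.measurableSet_level 1 0))
      (hlev 1 0 hh)
    exact hwan N (by omega) z hz hzN
  · obtain ⟨T', hT', hT1, hT2⟩ := hT.exists_inverse
    obtain ⟨S', hS', hS1, hS2⟩ := hS.isInvertibleNonsingular.exists_inverse
    have hfst : Measure.QuasiMeasurePreserving Prod.fst (μ.prod lebesgueHalfLine) μ :=
      Measure.quasiMeasurePreserving_fst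
    have hsnd : Measure.QuasiMeasurePreserving Prod.snd (μ.prod lebesgueHalfLine)
      lebesgueHalfLine := Measure.quasiMeasurePreserving_snd
    have hprod : Measure.QuasiMeasurePreserving (Prod.map T' S') (μ.prod lebesgueHalfLine)
        (μ.prod lebesgueHalfLine) := by
      refine ⟨hT'.measurable.prodMap hS'.measurable, ?_⟩
      have hmap := Measure.map_prod_map μ lebesgueHalfLine hT'.measurable hS'.measurable
      rw [← hmap]
      exact hT'.absolutelyContinuous.prod hS'.absolutelyContinuous
    refine not_quasiErgodic_of_wandering (R' := Prod.map T' S') hprod ?_ ?_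
      (hA.prod (P.measurableSet_level 2 (P.start 1 0 + 0))) (hlev _ _ (by omega))
      (hlev 2 (P.start 1 1 + 0) (by omega)) ?_
      fun N hN z hz hzN => hwan N hN z (hsub hz) (hsub hzN)
    · filter_upwards [hfst.ae hT1, hsnd.ae hS1] with z h1 h2
      exact Prod.ext h1 h2
    · filter_upwards [hfst.ae hT2, hsnd.ae hS2] with z h1 h2
      exact Prod.ext h1 h2
    · refine disjoint_left.2 fun z hz hz' => ?_
      have := P.level_unique (by omega) (by omega) hz.2 hz'.2
      omega

/-! ### Approximation by boxes of levels -/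

theorem tendsto_measure_sdiff_of_subset_cthickening {Z : Type*} [MetricSpace Z] [ProperSpace Z]
    [MeasurableSpace Z] [BorelSpace Z] (ρ : Measure Z) [IsFiniteMeasureOnCompacts ρ] {K : Set Z}
    (hK : IsCompact K) {w : ℕ → ℝ} (hw : Tendsto w atTop (𝓝 0)) {U : ℕ → Set Z}
    (hU : ∀ n, U n ⊆ Metric.cthickening (w n) K) :
    Tendsto (fun n => ρ (U n \ K)) atTop (𝓝 0) := by
  have h1 : Tendsto (fun n => ρ (Metric.cthickening (w n) K)) atTop (𝓝 (ρ K)) :=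
    (tendsto_measure_cthickening_of_isCompact hK).comp hw
  have h2 : Tendsto (fun n => ρ (Metric.cthickening (w n) K) - ρ K) atTop (𝓝 0) := by
    have := ENNReal.Tendsto.sub h1 (tendsto_const_nhds (x := ρ K)) (Or.inr hK.measure_ne_top)
    rwa [tsub_self] at this
  refine tendsto_of_tendsto_of_tendsto_of_le_of_le tendsto_const_nhds h2 (fun _ => zero_le)
    fun n => ?_
  rw [← measure_sdiff (Metric.self_subset_cthickening K) hK.measurableSet.nullMeasurableSet
    hK.measure_ne_top]
  exact measure_mono (sdiff_subset_sdiff_left (hU n))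

namespace CuttingParams

variable (P : CuttingParams)

/-- A box whose sides are levels of the `n`-th column. -/
def cell {ι : Type*} (n : ℕ) (j : ι → ℕ) : Set (ι → ℝ≥0) := univ.pi fun l => P.level n (j l)

theorem dist_le_of_mem_level {n j : ℕ} {x y : ℝ≥0} (hx : x ∈ P.level n j) (hy : y ∈ P.level n j) :
    dist x y ≤ P.width n := by
  obtain ⟨h1, h2⟩ := hx
  obtain ⟨h3, h4⟩ := hy
  rw [NNReal.dist_eq, abs_le]
  constructor <;> linarith

theorem ofReal_width (n : ℕ) :
    ENNReal.ofReal (P.width n) = P.cuts n * ENNReal.ofReal (P.width (n + 1)) := by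
  rw [P.width_eq n, ENNReal.ofReal_mul (Nat.cast_nonneg _), ENNReal.ofReal_natCast]

theorem eventually_forall_exists_mem_level
    (hlim : Tendsto (fun n => (P.height n : ℝ) * P.width n) atTop atTop) (b : ℝ) :
    ∀ᶠ n in atTop, ∀ x : ℝ≥0, (x : ℝ) ≤ b → ∃ j < P.height n, x ∈ P.level n j :=
  (hlim.eventually_gt_atTop b).mono fun _ hn _ hx => P.exists_mem_level (hx.trans_lt hn)

section Cells

variable {ι : Type*} [Fintype ι]

theorem measurableSet_cell (n : ℕ) (j : ι → ℕ) : MeasurableSet (P.cell n j) :=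
  MeasurableSet.univ_pi fun _ => P.measurableSet_level _ _

theorem pi_cell {n : ℕ} {j : ι → ℕ} (hj : ∀ l, j l < P.height n) :
    (Measure.pi fun _ : ι => lebesgueHalfLine) (P.cell n j) =
      ENNReal.ofReal (P.width n) ^ Fintype.card ι := by
  rw [cell, Measure.pi_pi, Finset.prod_congr rfl fun l _ => P.lebesgueHalfLine_level (hj l)]
  simp

omit [Fintype ι] in
theorem eq_of_mem_cell {n : ℕ} {j j' : ι → ℕ} (hj : ∀ l, j l < P.height n)
    (hj' : ∀ l, j' l < P.height n) {x : ι → ℝ≥0} (hx : x ∈ P.cell n j) (hx' : x ∈ P.cell n j') :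
    j = j' :=
  funext fun l => P.level_unique (hj l) (hj' l) (hx l (mem_univ l)) (hx' l (mem_univ l))

theorem cell_subset_cthickening {n : ℕ} {j : ι → ℕ} {K : Set (ι → ℝ≥0)}
    (h : (P.cell n j ∩ K).Nonempty) : P.cell n j ⊆ Metric.cthickening (P.width n) K := by
  obtain ⟨y, hy, hyK⟩ := h
  intro x hx
  refine Metric.mem_cthickening_of_dist_le x y _ _ hyK ?_
  exact (dist_pi_le_iff (P.width_pos n).le).2 fun l =>
    P.dist_le_of_mem_level (hx l (mem_univ l)) (hy l (mem_univ l))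

open Classical in
/-- The cells of the `n`-th column meeting `K`. -/
noncomputable def cellsMeeting (n : ℕ) (K : Set (ι → ℝ≥0)) : Finset (ι → ℕ) :=
  (Fintype.piFinset fun _ => Finset.range (P.height n)).filter fun j => (P.cell n j ∩ K).Nonempty

theorem mem_cellsMeeting {n : ℕ} {K : Set (ι → ℝ≥0)} {j : ι → ℕ} :
    j ∈ P.cellsMeeting n K ↔ (∀ l, j l < P.height n) ∧ (P.cell n j ∩ K).Nonempty := by
  simp [cellsMeeting]

theorem tendsto_measure_cellsMeeting_sdiff {K : Set (ι → ℝ≥0)} (hK : IsCompact K) :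
    Tendsto (fun n => (Measure.pi fun _ : ι => lebesgueHalfLine)
      ((⋃ j ∈ P.cellsMeeting n K, P.cell n j) \ K)) atTop (𝓝 0) :=
  tendsto_measure_sdiff_of_subset_cthickening _ hK P.tendsto_width fun _ =>
    iUnion₂_subset fun _ hj => P.cell_subset_cthickening (P.mem_cellsMeeting.1 hj).2

theorem eventually_subset_cellsMeeting
    (hlim : Tendsto (fun n => (P.height n : ℝ) * P.width n) atTop atTop) {K : Set (ι → ℝ≥0)}
    (hK : IsCompact K) :
    ∀ᶠ n in atTop, K ⊆ ⋃ j ∈ P.cellsMeeting n K, P.cell n j := by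
  obtain ⟨b, hb⟩ := hK.isBounded.subset_closedBall 0
  filter_upwards [P.eventually_forall_exists_mem_level hlim b] with n hn x hx
  have hxb : ∀ l, ((x l : ℝ≥0) : ℝ) ≤ b := fun l => by
    have h1 : dist x 0 ≤ b := hb hx
    have h2 := (dist_le_pi_dist x 0 l).trans h1
    rw [NNReal.dist_eq] at h2
    simpa using h2
  choose j hj hxj using fun l => hn (x l) (hxb l)
  have hxc : x ∈ P.cell n j := fun l _ => hxj l
  exact mem_iUnion₂.2 ⟨j, P.mem_cellsMeeting.2 ⟨hj, x, hxc, hx⟩, hxc⟩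

theorem measure_iUnion_cellsMeeting_inter (n : ℕ) (K : Set (ι → ℝ≥0)) {D : Set (ι → ℝ≥0)}
    (hD : MeasurableSet D) :
    (Measure.pi fun _ : ι => lebesgueHalfLine) ((⋃ j ∈ P.cellsMeeting n K, P.cell n j) ∩ D) =
      ∑ j ∈ P.cellsMeeting n K, (Measure.pi fun _ : ι => lebesgueHalfLine) (P.cell n j ∩ D) := by
  rw [iUnion₂_inter, measure_biUnion_finset]
  · intro j hj j' hj' hne
    refine disjoint_left.2 fun x hx hx' => hne ?_
    exact P.eq_of_mem_cell (P.mem_cellsMeeting.1 hj).1 (P.mem_cellsMeeting.1 hj').1 hx.1 hx'.1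
  · exact fun j _ => (P.measurableSet_cell n j).inter hD

/-- A set of positive measure nearly fills some cell of every sufficiently late column. -/
theorem eventually_exists_cell_sdiff_le
    (hlim : Tendsto (fun n => (P.height n : ℝ) * P.width n) atTop atTop) {D : Set (ι → ℝ≥0)}
    (hD : MeasurableSet D) (hD0 : (Measure.pi fun _ : ι => lebesgueHalfLine) D ≠ 0)
    {ε : ℝ≥0∞} (hε : ε ≠ 0) :
    ∀ᶠ n in atTop, ∃ j : ι → ℕ, (∀ l, j l < P.height n) ∧
      (Measure.pi fun _ : ι => lebesgueHalfLine) (P.cell n j \ D) ≤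
        ε * (Measure.pi fun _ : ι => lebesgueHalfLine) (P.cell n j) := by
  set ρ := Measure.pi fun _ : ι => lebesgueHalfLine
  obtain ⟨K, hKD, hK, hK0⟩ := hD.exists_lt_isCompact (pos_iff_ne_zero.2 hD0)
  filter_upwards [(P.tendsto_measure_cellsMeeting_sdiff hK).eventually_lt_const
    (pos_iff_ne_zero.2 (mul_ne_zero hε hK0.ne')), P.eventually_subset_cellsMeeting hlim hK]
    with n hn hKn
  by_contra! hcon
  refine hn.not_ge ?_
  calc ε * ρ K ≤ ε * ρ ((⋃ j ∈ P.cellsMeeting n K, P.cell n j) ∩ univ) := by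
        rw [inter_univ]; gcongr
    _ = ∑ j ∈ P.cellsMeeting n K, ε * ρ (P.cell n j) := by
        rw [P.measure_iUnion_cellsMeeting_inter n K .univ, Finset.mul_sum]
        simp only [inter_univ, ρ]
    _ ≤ ∑ j ∈ P.cellsMeeting n K, ρ (P.cell n j ∩ Dᶜ) :=
        Finset.sum_le_sum fun j hj => (hcon j (P.mem_cellsMeeting.1 hj).1).le
    _ = ρ ((⋃ j ∈ P.cellsMeeting n K, P.cell n j) ∩ Dᶜ) :=
        (P.measure_iUnion_cellsMeeting_inter n K hD.compl).symm
    _ ≤ ρ ((⋃ j ∈ P.cellsMeeting n K, P.cell n j) \ K) :=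
        measure_mono (sdiff_subset_sdiff_right hKD)

end Cells

end CuttingParams

/-! ### Ergodicity of products of Chacon-like maps -/

theorem iterate_pi_map {ι Y : Type*} (S : Y → Y) (N : ℕ) :
    (fun (x : ι → Y) l => S (x l))^[N] = fun x l => S^[N] (x l) := by
  induction N with
  | zero => rfl
  | succ N ih => rw [Function.iterate_succ, ih]; rfl

namespace CuttingParams

namespace Generates

variable {P : CuttingParams} {S : ℝ≥0 → ℝ≥0} (hS : P.Generates S)
include hS

section Product

variable {ι : Type*} [Fintype ι] [DecidableEq ι]

omit [DecidableEq ι] in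
theorem measurePreserving_pi :
    MeasurePreserving (fun (x : ι → ℝ≥0) l => S (x l)) (Measure.pi fun _ => lebesgueHalfLine)
      (Measure.pi fun _ => lebesgueHalfLine) :=
  MeasureTheory.measurePreserving_pi _ _ fun _ => hS.measurePreserving

theorem measurePreserving_update (i : ι) :
    MeasurePreserving (fun x : ι → ℝ≥0 => Function.update x i (S (x i)))
      (Measure.pi fun _ => lebesgueHalfLine) (Measure.pi fun _ => lebesgueHalfLine) := by
  have h : (fun x : ι → ℝ≥0 => Function.update x i (S (x i))) =
      fun x l => (if l = i then S else id) (x l) := by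
    funext x l
    by_cases hl : l = i
    · subst hl; simp
    · simp [hl]
  rw [h]
  refine MeasureTheory.measurePreserving_pi _ _ fun l => ?_
  split_ifs
  · exact hS.measurePreserving
  · exact MeasurePreserving.id _

omit [Fintype ι] in
theorem preimage_update_cell {n : ℕ} {i : ι} {j : ι → ℕ} (hi : j i + 1 < P.height n) :
    (fun x : ι → ℝ≥0 => Function.update x i (S (x i))) ⁻¹'
      P.cell n (Function.update j i (j i + 1)) = P.cell n j := by
  ext x
  simp only [cell, mem_preimage, mem_univ_pi]
  refine forall_congr' fun l => ?_
  by_cases hl : l = i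
  · subst hl
    rw [Function.update_self, Function.update_self, ← mem_preimage, hS.preimage_level_succ hi]
  · rw [Function.update_of_ne hl, Function.update_of_ne hl]

omit [Fintype ι] [DecidableEq ι] in
theorem preimage_iterate_cell {n N : ℕ} {j : ι → ℕ} (hj : ∀ l, j l + N < P.height n) :
    (fun (x : ι → ℝ≥0) l => S (x l))^[N] ⁻¹' P.cell n (fun l => j l + N) = P.cell n j := by
  rw [iterate_pi_map]
  ext x
  simp only [cell, mem_preimage, mem_univ_pi]
  refine forall_congr' fun l => ?_
  rw [← mem_preimage, hS.preimage_iterate_level (hj l)]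

/-- For a Chacon-like construction, a set invariant under the product transformation is invariant
under the transformation of a single coordinate. -/
theorem measure_sdiff_preimage_update (hc : ∀ n, P.cuts n = 3) (h0 : ∀ n, P.spacers n 0 = 0)
    (h1 : ∀ n, P.spacers n 1 = 1) {A : Set (ι → ℝ≥0)} (hA : MeasurableSet A)
    (hAS : (fun (x : ι → ℝ≥0) l => S (x l)) ⁻¹' A = A) (i : ι) :
    (Measure.pi fun _ : ι => lebesgueHalfLine)
      (A \ (fun x : ι → ℝ≥0 => Function.update x i (S (x i))) ⁻¹' A) = 0 := by
  set ρ := Measure.pi fun _ : ι => lebesgueHalfLine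
  set φ := fun x : ι → ℝ≥0 => Function.update x i (S (x i))
  have hφ : MeasurePreserving φ ρ ρ := hS.measurePreserving_update i
  by_contra hD0
  have hD : MeasurableSet (A \ φ ⁻¹' A) := hA.diff (hφ.measurable hA)
  set d := Fintype.card ι
  have h3d : (3 : ℝ≥0∞) ^ d ≠ 0 := pow_ne_zero _ (by norm_num)
  have h3d' : (3 : ℝ≥0∞) ^ d ≠ ⊤ := ENNReal.pow_ne_top (by norm_num)
  -- The cell consists of `3 ^ d` subcells of measure `w`; this `ε` makes the part outside `A \ φ
  -- ⁻¹' A` at most `w / 3`.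
  obtain ⟨n, j, hj, hle⟩ := (P.eventually_exists_cell_sdiff_le hS.tendsto_height hD hD0
    (ε := (3 * 3 ^ d)⁻¹) (ENNReal.inv_ne_zero.2 (ENNReal.mul_ne_top (by norm_num) h3d'))).exists
  set h := P.height n
  have hs1 : P.start n 1 = h := by rw [P.start_eq]; simp [h0, h]
  have hs2 : P.start n 2 = 2 * h + 1 := by
    rw [P.start_eq, Finset.sum_range_succ, Finset.sum_range_one, h0, h1, zero_add]
  have hc' : 2 < P.cuts n := by rw [hc]; norm_num
  have hh : P.start n 2 + h ≤ P.height (n + 1) := by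
    have := P.start_add_height_add_spacers_le hc'
    omega
  set w := ENNReal.ofReal (P.width (n + 1)) ^ d
  have hw0 : w ≠ 0 := pow_ne_zero _ (ENNReal.ofReal_pos.2 (P.width_pos _)).ne'
  have hwt : w ≠ ⊤ := ENNReal.pow_ne_top ENNReal.ofReal_ne_top
  have hcell : ρ (P.cell n j) = 3 ^ d * w := by
    rw [P.pi_cell hj, P.ofReal_width, hc, mul_pow]
    rfl
  have hle' : ρ (P.cell n j \ (A \ φ ⁻¹' A)) ≤ w / 3 := by
    refine hle.trans_eq ?_
    rw [hcell, ENNReal.mul_inv (Or.inl (by norm_num)) (Or.inl (by norm_num)), mul_assoc,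
      ← mul_assoc _ _ w, ENNReal.inv_mul_cancel h3d h3d', one_mul, mul_comm, div_eq_mul_inv]
  -- In `p` coordinate `i` is in subcolumn 0 and the others in subcolumn 1; in `q` they are in
  -- subcolumns 1 and 2. After `h + 1` steps the others cross the single spacer and match `q`, while
  -- coordinate `i` is one level too high. So `p` flows onto the `φ`-image of `q`: `A` fills most of
  -- `p`, hence `φ ⁻¹' A` fills most of `q`, which it should nearly avoid.
  let p : ι → ℕ := fun l => if l = i then j l else h + j l
  let q : ι → ℕ := fun l => if l = i then h + j l else 2 * h + 1 + j l
  have hp : ∀ l, p l + (h + 1) < P.height (n + 1) := fun l => by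
    have := hj l
    simp only [p]
    split_ifs <;> omega
  have hq : ∀ l, q l < P.height (n + 1) := fun l => by
    have := hj l
    simp only [q]
    split_ifs <;> omega
  have hqi : q i + 1 < P.height (n + 1) := by
    have := hj i
    simp only [q, if_true]
    omega
  have hpq : (fun l => p l + (h + 1)) = Function.update q i (q i + 1) := by
    funext l
    by_cases hl : l = i
    · subst hl
      simp only [p, q, if_true, Function.update_self]
      omega
    · simp only [p, q, hl, if_false, ne_eq, not_false_eq_true, Function.update_of_ne]
      omega
  have hpsub : P.cell (n + 1) p ⊆ P.cell n j := by
    refine pi_mono fun l _ => ?_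
    by_cases hl : l = i
    · have := P.level_succ_subset (i := 0) (by omega) (hj l)
      simpa [p, hl, P.start_zero] using this
    · have := P.level_succ_subset (i := 1) (by omega) (hj l)
      simpa [p, hl, hs1] using this
  have hqsub : P.cell (n + 1) q ⊆ P.cell n j := by
    refine pi_mono fun l _ => ?_
    by_cases hl : l = i
    · have := P.level_succ_subset (i := 1) (by omega) (hj l)
      simpa [q, hl, hs1] using this
    · have := P.level_succ_subset (i := 2) (by omega) (hj l)
      simpa [q, hl, hs2] using this
  have hAN : (fun (x : ι → ℝ≥0) l => S (x l))^[h + 1] ⁻¹' A = A := by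
    rw [preimage_iterate_eq]
    exact Function.iterate_fixed hAS _
  set F := P.cell (n + 1) fun l => p l + (h + 1) with hF
  have hAF : MeasurableSet (A ∩ F) := hA.inter (P.measurableSet_cell _ _)
  have e1 : ρ (A ∩ P.cell (n + 1) p) = ρ (A ∩ F) := by
    rw [← (hS.measurePreserving_pi.iterate (h + 1)).measure_preimage hAF.nullMeasurableSet,
      preimage_inter, hAN, hS.preimage_iterate_cell hp]
  have e2 : ρ (φ ⁻¹' A ∩ P.cell (n + 1) q) = ρ (A ∩ F) := by
    rw [← hφ.measure_preimage hAF.nullMeasurableSet, preimage_inter, hF, hpq,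
      hS.preimage_update_cell hqi]
  have b1 : w ≤ ρ (A ∩ P.cell (n + 1) p) + w / 3 := by
    calc w = ρ (P.cell (n + 1) p) := (P.pi_cell fun l => by have := hp l; omega).symm
      _ ≤ ρ ((A ∩ P.cell (n + 1) p) ∪ (P.cell n j \ (A \ φ ⁻¹' A))) := by
          refine measure_mono fun x hx => ?_
          by_cases hxA : x ∈ A
          · exact Or.inl ⟨hxA, hx⟩
          · exact Or.inr ⟨hpsub hx, fun h => hxA h.1⟩
      _ ≤ _ := (measure_union_le _ _).trans (by gcongr)
  have b2 : ρ (φ ⁻¹' A ∩ P.cell (n + 1) q) ≤ w / 3 :=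
    (measure_mono fun x hx => (⟨hqsub hx.2, fun h => h.2 hx.1⟩ :
      x ∈ P.cell n j \ (A \ φ ⁻¹' A))).trans hle'
  rw [e1, ← e2] at b1
  have b3 : w ≤ w / 3 + w / 3 := b1.trans (by gcongr)
  have b4 : w / 3 + w / 3 < w := by
    calc w / 3 + w / 3 < w / 3 + w / 3 + w / 3 :=
          ENNReal.lt_add_right (by simp [ENNReal.div_eq_top, hwt])
            (ENNReal.div_pos hw0 (by norm_num)).ne'
      _ = w := ENNReal.add_thirds w
  exact absurd b3 b4.not_ge

/-- Products of a Chacon-like construction are ergodic. -/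
theorem ergodic_pi (hc : ∀ n, P.cuts n = 3) (h0 : ∀ n, P.spacers n 0 = 0)
    (h1 : ∀ n, P.spacers n 1 = 1) :
    Ergodic (fun (x : ι → ℝ≥0) l => S (x l)) (Measure.pi fun _ => lebesgueHalfLine) := by
  refine { hS.measurePreserving_pi with aeconst_set := fun A hA hAS => ?_ }
  set ρ := Measure.pi fun _ : ι => lebesgueHalfLine
  have hinv : ∀ i, (fun x : ι → ℝ≥0 => Function.update x i (S (x i))) ⁻¹' A =ᵐ[ρ] A := fun i => by
    refine Filter.EventuallyLE.antisymm (ae_le_set.2 ?_) (ae_le_set.2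
      (hS.measure_sdiff_preimage_update hc h0 h1 hA hAS i))
    have := hS.measure_sdiff_preimage_update hc h0 h1 hA.compl
      (by rw [preimage_compl, hAS]) i
    rwa [preimage_compl, compl_sdiff_compl] at this
  -- Moving one coordinate down one level at a time shows that `A` has the same measure in all cells
  -- of a column. It then cannot fill two thirds of one cell while its complement fills two thirds
  -- of another.
  have hconst : ∀ n s, ∀ j : ι → ℕ, (∀ l, j l < P.height n) → ∑ l, j l = s →
      ρ (A ∩ P.cell n j) = ρ (A ∩ P.cell n fun _ => 0) := by
    intro n s
    induction s with
    | zero =>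
      intro j _ hsum
      have : j = fun _ => 0 := funext fun l => by simpa using Finset.sum_eq_zero_iff.1 hsum l
      rw [this]
    | succ s ih =>
      intro j hj hsum
      obtain ⟨i, -, hi⟩ := Finset.exists_ne_zero_of_sum_ne_zero (hsum.trans_ne s.succ_ne_zero)
      obtain ⟨t, ht⟩ := Nat.exists_eq_succ_of_ne_zero hi
      set j' := Function.update j i t with hj'
      have hj'i : j' i = t := Function.update_self ..
      have hjj : j = Function.update j' i (j' i + 1) := by
        rw [hj'i, hj', Function.update_idem, ← Nat.succ_eq_add_one, ← ht, Function.update_eq_self]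
      have hlt : j' i + 1 < P.height n := by
        rw [hj'i]; have := hj i; omega
      rw [← ih j' ?_ ?_]
      · rw [hjj, ← (hS.measurePreserving_update i).measure_preimage
          (hA.inter (P.measurableSet_cell _ _)).nullMeasurableSet, preimage_inter,
          hS.preimage_update_cell hlt]
        exact measure_congr ((hinv i).inter (ae_eq_refl _))
      · intro l
        by_cases hl : l = i
        · rw [hl]; omega
        · rw [hj', Function.update_of_ne hl]; exact hj l
      · have h2 := Finset.sum_update_of_mem (Finset.mem_univ i) j' (j' i + 1)
        have h3 := Finset.sum_update_of_mem (Finset.mem_univ i) j' (j' i)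
        rw [← hjj] at h2
        rw [Function.update_eq_self] at h3
        have hsum' : ∑ l, j l = s + 1 := hsum
        omega
  have h01 : ρ A = 0 ∨ ρ Aᶜ = 0 := by
    by_contra! hcon
    have h3 : ((3 : ℝ≥0∞)⁻¹) ≠ 0 := by simp
    obtain ⟨n, ⟨j, hj, hjA⟩, j', hj', hjA'⟩ :=
      ((P.eventually_exists_cell_sdiff_le hS.tendsto_height hA hcon.1 h3).and
        (P.eventually_exists_cell_sdiff_le hS.tendsto_height hA.compl hcon.2 h3)).exists
    set w := ENNReal.ofReal (P.width n) ^ Fintype.card ι with hw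
    have hw0 : w ≠ 0 := pow_ne_zero _ (ENNReal.ofReal_pos.2 (P.width_pos _)).ne'
    have hwt : w ≠ ⊤ := ENNReal.pow_ne_top ENNReal.ofReal_ne_top
    rw [P.pi_cell hj, ← hw, mul_comm, ← div_eq_mul_inv] at hjA
    rw [P.pi_cell hj', ← hw, mul_comm, ← div_eq_mul_inv, Set.sdiff_compl, inter_comm,
      hconst n _ j' hj' rfl, ← hconst n _ j hj rfl] at hjA'
    have b3 : w ≤ w / 3 + w / 3 := by
      calc w = ρ (P.cell n j) := (P.pi_cell hj).symm
        _ ≤ ρ (P.cell n j ∩ A) + ρ (P.cell n j \ A) := measure_le_inter_add_sdiff _ _ _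
        _ ≤ _ := by rw [inter_comm]; gcongr
    have b4 : w / 3 + w / 3 < w := by
      calc w / 3 + w / 3 < w / 3 + w / 3 + w / 3 :=
            ENNReal.lt_add_right (by simp [ENNReal.div_eq_top, hwt])
              (ENNReal.div_pos hw0 (by norm_num)).ne'
        _ = w := ENNReal.add_thirds w
    exact absurd b3 b4.not_ge
  rw [eventuallyConst_set']
  exact h01.imp ae_eq_empty.2 ae_eq_univ.2

end Product

end Generates

end CuttingParams

/-! ### Rigidity along the heights -/

namespace CuttingParams

/-- Without inner spacers, after `height n` steps every point of a level returns to that level,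
except on the last subcolumn, a fraction `1 / cuts n` that tends to `0`. -/
theorem Generates.isRigid {P : CuttingParams} {S : ℝ≥0 → ℝ≥0} (hS : P.Generates S)
    (hc : Tendsto P.cuts atTop atTop) (h0 : ∀ n l, l + 1 < P.cuts n → P.spacers n l = 0) :
    IsRigid S lebesgueHalfLine := by
  refine ⟨P.height, P.strictMono_height, fun A hA _ _ => ?_⟩
  -- The half-line is viewed as a product with one factor, so that approximation by cells applies.
  set ρ : Measure (Unit → ℝ≥0) := Measure.pi fun _ => lebesgueHalfLine
  have hev : MeasurePreserving (fun x : Unit → ℝ≥0 => x ()) ρ lebesgueHalfLine :=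
    measurePreserving_funUnique lebesgueHalfLine Unit
  set G : (Unit → ℝ≥0) → Unit → ℝ≥0 := fun x l => S (x l) with hGdef
  have hG : MeasurePreserving G ρ ρ := hS.measurePreserving_pi
  refine le_of_forall_lt fun c hcA => ?_
  have hA' : MeasurableSet ((fun x : Unit → ℝ≥0 => x ()) ⁻¹' A) := hev.measurable hA
  rw [← hev.measure_preimage hA.nullMeasurableSet] at hcA
  obtain ⟨c', hcc', hcA⟩ := exists_between hcA
  obtain ⟨K, hKA, hK, hcK⟩ := hA'.exists_lt_isCompact hcA
  refine hcc'.trans_le (le_liminf_of_le (by isBoundedDefault) ?_)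
  have hKt : ρ K ≠ ⊤ := hK.measure_ne_top
  let U : ℕ → Set (Unit → ℝ≥0) := fun n => ⋃ j ∈ P.cellsMeeting n K, P.cell n j
  have hU : Tendsto (fun n => ρ (U n \ K)) atTop (𝓝 0) := P.tendsto_measure_cellsMeeting_sdiff hK
  have hcinv : Tendsto (fun n => ((P.cuts n : ℝ≥0∞))⁻¹) atTop (𝓝 0) :=
    ENNReal.tendsto_inv_nat_nhds_zero.comp hc
  have herr : Tendsto (fun n => ρ (U n \ K) + (ρ K + ρ (U n \ K)) * ((P.cuts n : ℝ≥0∞))⁻¹)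
      atTop (𝓝 0) := by
    have := hU.add (ENNReal.Tendsto.mul (hU.const_add (ρ K)) (Or.inr ENNReal.zero_ne_top) hcinv
      (Or.inr (by simpa using hKt)))
    simpa using this
  filter_upwards [herr.eventually_lt_const (tsub_pos_of_lt hcK),
    P.eventually_subset_cellsMeeting hS.tendsto_height hK] with n hn hKU
  obtain ⟨r, hr⟩ : ∃ r, P.cuts n = r + 1 := ⟨P.cuts n - 1, by have := P.cuts_pos n; omega⟩
  let V : Set (Unit → ℝ≥0) :=
    ⋃ j ∈ P.cellsMeeting n K, P.cell (n + 1) fun l => P.start n r + j l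
  have hVU : P.cuts n * ρ V ≤ ρ K + ρ (U n \ K) := by
    calc P.cuts n * ρ V ≤ P.cuts n * ∑ j ∈ P.cellsMeeting n K,
          ρ (P.cell (n + 1) fun l => P.start n r + j l) := by
            gcongr; exact measure_biUnion_finset_le _ _
      _ = ∑ j ∈ P.cellsMeeting n K, ρ (P.cell n j) := by
          rw [Finset.mul_sum]
          refine Finset.sum_congr rfl fun j hj => ?_
          have hj' := (P.mem_cellsMeeting.1 hj).1
          have hle := P.start_add_height_add_spacers_le (show r < P.cuts n by omega)
          rw [P.pi_cell hj', P.pi_cell fun l => by have := hj' l; omega, P.ofReal_width n]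
          simp
      _ = ρ (U n) := by
          have := P.measure_iUnion_cellsMeeting_inter n K .univ
          simp only [inter_univ] at this
          exact this.symm
      _ ≤ ρ (K ∪ (U n \ K)) := measure_mono (by rw [union_sdiff_self]; exact subset_union_right)
      _ ≤ _ := measure_union_le _ _
  have hV : ρ V ≤ (ρ K + ρ (U n \ K)) * ((P.cuts n : ℝ≥0∞))⁻¹ := by
    rw [← div_eq_mul_inv, ENNReal.le_div_iff_mul_le
      (Or.inl (Nat.cast_ne_zero.2 (P.cuts_pos n).ne')) (Or.inl (ENNReal.natCast_ne_top _)), mul_comm]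
    exact hVU
  have hret : ∀ x ∈ K, x ∉ V → G^[P.height n] x ∈ U n := by
    intro x hx hxV
    obtain ⟨j, hj, hxj⟩ := mem_iUnion₂.1 (hKU hx)
    have hj' := (P.mem_cellsMeeting.1 hj).1
    refine mem_iUnion₂.2 ⟨j, hj, fun l _ => ?_⟩
    obtain ⟨i, hi, hxi⟩ := P.exists_mem_level_succ (hj' l) (hxj l (mem_univ l))
    have hir : i ≠ r := by
      rintro rfl
      exact hxV (mem_iUnion₂.2 ⟨j, hj, fun _ _ => hxi⟩)
    have hi1 : i + 1 < P.cuts n := by omega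
    have hs : P.start n (i + 1) = P.start n i + P.height n := by
      rw [P.start_succ, h0 n i hi1, add_zero]
    have hle := P.start_add_height_add_spacers_le hi1
    have hjl := hj' l
    have hm := hS.iterate_mem_level (N := P.height n) (by omega) hxi
    rw [show P.start n i + j l + P.height n = P.start n (i + 1) + j l by omega] at hm
    rw [iterate_pi_map]
    exact P.level_succ_subset hi1 hjl hm
  have hGn : MeasurePreserving G^[P.height n] ρ ρ := hG.iterate _
  have hUm : MeasurableSet (U n \ K) :=
    (Finset.measurableSet_biUnion _ fun j _ => P.measurableSet_cell n j).diff hK.measurableSet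
  have hmain : ρ K ≤ lebesgueHalfLine (S^[P.height n] ⁻¹' A ∩ A) +
      (ρ (U n \ K) + (ρ K + ρ (U n \ K)) * ((P.cuts n : ℝ≥0∞))⁻¹) := by
    rw [← hev.measure_preimage
      ((hS.measurable.iterate _ hA).inter hA).nullMeasurableSet]
    -- A point of `K` either returns to `K`, or lands in `U n \ K`, or lies in the part `V` of the
    -- last subcolumn.
    calc ρ K ≤ ρ ((fun x : Unit → ℝ≥0 => x ()) ⁻¹' (S^[P.height n] ⁻¹' A ∩ A) ∪
          (G^[P.height n] ⁻¹' (U n \ K) ∪ V)) := by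
          refine measure_mono fun x hx => ?_
          by_cases hxV : x ∈ V
          · exact Or.inr (Or.inr hxV)
          by_cases hxK : G^[P.height n] x ∈ K
          · refine Or.inl ⟨?_, hKA hx⟩
            have := hKA hxK
            rw [hGdef, iterate_pi_map] at this
            exact this
          · exact Or.inr (Or.inl ⟨hret x hx hxV, hxK⟩)
      _ ≤ _ := (measure_union_le _ _).trans (add_le_add le_rfl ((measure_union_le _ _).trans
          (add_le_add (hGn.measure_preimage hUm.nullMeasurableSet).le hV)))
  have hlt := lt_tsub_iff_right.1 hn
  rw [add_comm] at hlt
  exact (ENNReal.add_lt_add_iff_right (ne_top_of_le_ne_top hKt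
    (hn.le.trans tsub_le_self))).1 (hlt.trans_le hmain) |>.le

end CuttingParams

/-! ### The three constructions -/

theorem mainTheorem1 {X : Type*} [MeasurableSpace X] (μ : Measure X) [SigmaFinite μ]
    (T : X → X) (hT : IsInvertibleNonsingular T μ) (hfin : ¬ HasFiniteInvariantMeasure T μ) :
    (∃ S : ℝ≥0 → ℝ≥0, IsRankOne S ∧ IsSkyscraper S ∧
      IsInvertibleNonsingular S lebesgueHalfLine ∧
      MeasurePreserving S lebesgueHalfLine lebesgueHalfLine ∧
      ¬ Conservative (Prod.map T S) (μ.prod lebesgueHalfLine) ∧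
      ¬ QuasiErgodic (Prod.map T S) (μ.prod lebesgueHalfLine)) ∧
    (∃ S : ℝ≥0 → ℝ≥0, IsRankOne S ∧ IsRigid S lebesgueHalfLine ∧
      IsInvertibleNonsingular S lebesgueHalfLine ∧
      MeasurePreserving S lebesgueHalfLine lebesgueHalfLine ∧
      ¬ Conservative (Prod.map T S) (μ.prod lebesgueHalfLine) ∧
      ¬ QuasiErgodic (Prod.map T S) (μ.prod lebesgueHalfLine)) ∧
    (∃ S : ℝ≥0 → ℝ≥0, IsRankOne S ∧ HasInfiniteErgodicIndex S lebesgueHalfLine ∧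
      IsInvertibleNonsingular S lebesgueHalfLine ∧
      MeasurePreserving S lebesgueHalfLine lebesgueHalfLine ∧
      ¬ Conservative (Prod.map T S) (μ.prod lebesgueHalfLine) ∧
      ¬ QuasiErgodic (Prod.map T S) (μ.prod lebesgueHalfLine)) := by
  refine ⟨?_, ?_, ?_⟩
  · obtain ⟨P, hc, hs, S, hS, A, hA, hA0, hAS⟩ := exists_generates_disjoint_return_times μ T hT hfin
      (fun _ => 2) (fun _ => le_rfl) fun _ _ => 0
    exact ⟨S, ⟨P, hS⟩, ⟨P, fun n => ⟨congrFun hc n, hs n 0 (by norm_num)⟩, hS⟩,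
      hS.isInvertibleNonsingular, hS.measurePreserving,
      hS.not_conservative_not_quasiErgodic hT hA hA0 hAS⟩
  · obtain ⟨P, hc, hs, S, hS, A, hA, hA0, hAS⟩ := exists_generates_disjoint_return_times μ T hT hfin
      (fun n => n + 2) (fun _ => by omega) fun _ _ => 0
    refine ⟨S, ⟨P, hS⟩, hS.isRigid ?_ fun n l hl => hs n l ?_,
      hS.isInvertibleNonsingular, hS.measurePreserving,
      hS.not_conservative_not_quasiErgodic hT hA hA0 hAS⟩
    · rw [hc]; exact tendsto_add_atTop_nat 2
    · rwa [hc] at hl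
  -- With three cuts, `l` spacers on subcolumn `l` means none on the first and one on the middle.
  · obtain ⟨P, hc, hs, S, hS, A, hA, hA0, hAS⟩ := exists_generates_disjoint_return_times μ T hT hfin
      (fun _ => 3) (fun _ => by norm_num) fun _ l => l
    exact ⟨S, ⟨P, hS⟩, fun k _ => hS.ergodic_pi (congrFun hc) (fun n => hs n 0 (by norm_num))
      fun n => hs n 1 (by norm_num), hS.isInvertibleNonsingular, hS.measurePreserving,
      hS.not_conservative_not_quasiErgodic hT hA hA0 hAS⟩
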